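/- Let $\Sigma\subset\mathbb R^n$ be a closed (boundaryless) smooth submanifold of codimension $d\ge 1$ that admits a global smooth orthonormal frame $\mathbf n_1,\dots,\mathbf n_d$ of its normal bundle; fix such a frame. Fix also a tubular neighbourhood $\Sigma^{\epsilon}=\{x:\|x-\xi\|<\epsilon(\xi)\text{ for some }\xi\in\Sigma\}$, with $\epsilon:\Sigma\to(0,\infty)$ continuous, in which every point $x$ has a unique closest point $\xi_x=\pi(x)\in\Sigma$ and $\pi:\Sigma^\epsilon\to\Sigma$ is a smooth submersion. For $x\in\Sigma^\epsilon\setminus\Sigma$ put $\rho_x=\|x-\pi(x)\|$ and $\omega_x=\big(\mathbf n_k(\xi_x)\cdot(x-\xi_x)/\rho_x\big)_{k=1}^d\in\mathbb S^{d-1}$. Let $\Omega\subset\mathbb R^n$ be open with $\Omega\cap\Sigma\ne\emptyset$. Let $\mathcal D_{*,\Sigma}(\Omega)$ be the space of all $\phi\in C^\infty(\Omega\setminus\Sigma)$ that vanish outside some compact subset of $\Omega$ and admit near $\Sigma$ a uniform expansion $\phi(x)\sim\sum_{j\ge m}a_j(\xi_x,\omega_x)\rho_x^j$ as $\rho_x\to0$,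 for some $m\in\mathbb Z$ and some $a_j=a_j^\phi\in C^\infty((\Sigma\cap\Omega)\times\mathbb S^{d-1})$, that is strong, i.e. may be differentiated term by term in $x$ any number of times. For a compact $K\subset\Omega$ and $m\in\mathbb Z$, those $\phi$ that vanish outside $K$ and have an expansion starting at $j=m$ form a Fréchet space for the norms of the derivatives of the remainders of the expansion near $\Sigma$ (weighted by the appropriate powers of $\rho_x$) and of the derivatives of $\phi$ away from $\Sigma$; $\mathcal D_{*,\Sigma}(\Omega)$ is the inductive limit of these spaces, and $\mathcal D'_{*,\Sigma}(\Omega)$ is its dual. Let $\Pi:\mathcal D'_{*,\Sigma}(\Omega)\to\mathcal D'(\Omega)$ be the transpose of the inclusion $\mathcal D(\Omega)\hookrightarrow\mathcal D_{*,\Sigma}(\Omega)$. For $g\in\mathcal D'((\Sigma\cap\Omega)\times\mathbb S^{d-1})$ and $j\in\mathbb Z$, the thick delta function of degree $j$ is $g\delta_{*,\Sigma}^{[j]}\in\mathcal D'_{*,\Sigma}(\Omega)$, $\langle g\delta_{*,\Sigma}^{[j]},\phi\rangle=|\mathbb S^{d-1}|^{-1}\langle g,a_j^\phi\rangle$. For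 $\alpha\in\mathbb N^d$ and $\varphi\in\mathcal D(\Omega)$ put $$D_{\mathbf n}^\alpha\varphi(\xi)=\frac{\partial^\alpha}{\partial y^\alpha}\,\varphi\Big(\xi+\sum_{k=1}^d y_k\mathbf n_k(\xi)\Big)\Big|_{y=0},\qquad \xi\in\Sigma\cap\Omega,$$ and for $h\in\mathcal D'(\Sigma\cap\Omega)$ define the multilayer $\bar D_{\mathbf n}^\alpha(h\delta_\Sigma)\in\mathcal D'(\Omega)$ by $\langle\bar D_{\mathbf n}^\alpha(h\delta_\Sigma),\varphi\rangle=(-1)^{|\alpha|}\langle h,D_{\mathbf n}^\alpha\varphi\rangle$. **Proposition.** Let $g\in\mathcal D'((\Sigma\cap\Omega)\times\mathbb S^{d-1})$ and let $j\ge0$ be an integer. Then $g\delta_{*,\Sigma}^{[j]}$ and, for every $\alpha\in\mathbb N^d$, $\bar D_{\mathbf n}^\alpha(h_\alpha\delta_\Sigma)$ are well defined elements of $\mathcal D'_{*,\Sigma}(\Omega)$ and of $\mathcal D'(\Omega)$, respectively, where $h_\alpha\in\mathcal D'(\Sigma\cap\Omega)$ is given by $h_\alpha(\xi)=\langle g(\xi,\omega),\omega^\alpha\rangle$,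 i.e. $\langle h_\alpha,\chi\rangle=\langle g,\chi(\xi)\,\omega^\alpha\rangle$ for $\chi\in\mathcal D(\Sigma\cap\Omega)$; and $$\Pi\big(g\delta_{*,\Sigma}^{[j]}\big)=\frac{(-1)^j}{|\mathbb S^{d-1}|}\sum_{|\alpha|=j}\frac{\bar D_{\mathbf n}^\alpha(h_\alpha\delta_\Sigma)}{\alpha!}.$$ -/

import Mathlib

open Set Filter Topology Metric
open scoped ContDiff Distributions

namespace ThickDist

/-- Euclidean space `ℝⁿ`. -/
abbrev Euc (n : ℕ) := EuclideanSpace ℝ (Fin n)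

section Subsets

set_option linter.unusedSectionVars false

variable {F G : Type*} [NormedAddCommGroup F] [NormedSpace ℝ F]
  [NormedAddCommGroup G] [NormedSpace ℝ G]

/-- `f` is smooth on the subset `M` of a Euclidean space: near each point of `M`, it agrees on `M`
with a smooth function of the ambient space.  Only the values of `f` on `M` matter. -/
def SmoothOnSubset (M : Set F) (f : F → G) : Prop :=
  ∀ x ∈ M, ∃ f' : F → G, ContDiff ℝ ∞ f' ∧ f =ᶠ[𝓝[M] x] f'

open Classical in
/-- Extension by zero of a function defined on the subset `M`. -/
noncomputable def zeroExt (M : Set F) (f : M → ℂ) : F → ℂ :=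
  fun x => if h : x ∈ M then f ⟨x, h⟩ else 0

lemma zeroExt_of_mem {M : Set F} (f : M → ℂ) {x : F} (h : x ∈ M) : zeroExt M f x = f ⟨x, h⟩ := by
  simp [zeroExt, h]

lemma zeroExt_add {M : Set F} (f g : M → ℂ) : zeroExt M (f + g) = zeroExt M f + zeroExt M g := by
  funext x
  by_cases h : x ∈ M <;> simp [zeroExt, h]

lemma zeroExt_smul {M : Set F} (c : ℂ) (f : M → ℂ) : zeroExt M (c • f) = c • zeroExt M f := by
  funext x
  by_cases h : x ∈ M <;> simp [zeroExt, h]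

lemma zeroExt_zero {M : Set F} : zeroExt M (0 : M → ℂ) = 0 := by
  funext x
  by_cases h : x ∈ M <;> simp [zeroExt, h]

lemma SmoothOnSubset.add {M : Set F} {f g : F → G} (hf : SmoothOnSubset M f)
    (hg : SmoothOnSubset M g) : SmoothOnSubset M (f + g) := by
  intro x hx
  obtain ⟨f', hf', hff⟩ := hf x hx
  obtain ⟨g', hg', hgg⟩ := hg x hx
  exact ⟨f' + g', hf'.add hg', hff.add hgg⟩

lemma SmoothOnSubset.smul {M : Set F} {f : F → ℂ} (c : ℂ) (hf : SmoothOnSubset M f) :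
    SmoothOnSubset M (c • f) := by
  intro x hx
  obtain ⟨f', hf', hff⟩ := hf x hx
  exact ⟨c • f', contDiff_const.smul hf', hff.const_smul c⟩

lemma SmoothOnSubset.zero {M : Set F} : SmoothOnSubset M (0 : F → G) :=
  fun _ _ => ⟨0, contDiff_const, EventuallyEq.rfl⟩

/-- The space `𝓓(M)` of compactly supported smooth functions on an embedded submanifold `M` of a
Euclidean space. -/
def SubTest (M : Set F) : Submodule ℂ (M → ℂ) where
  carrier := {f | SmoothOnSubset M (zeroExt M f) ∧ HasCompactSupport f}
  add_mem' := by
    rintro f g ⟨hf, hf'⟩ ⟨hg, hg'⟩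
    exact ⟨by rw [zeroExt_add]; exact hf.add hg, hf'.add hg'⟩
  zero_mem' := ⟨by rw [zeroExt_zero]; exact SmoothOnSubset.zero, HasCompactSupport.zero⟩
  smul_mem' := by
    rintro c f ⟨hf, hf'⟩
    exact ⟨by rw [zeroExt_smul]; exact hf.smul c, hf'.smul_left (f := fun _ => c)⟩

/-- The space `𝓓'(M)` of distributions on an embedded submanifold `M`: linear functionals on
`𝓓(M)` which are continuous on the test functions supported in any given compact `K ⊆ M`, for the
topology of the `C^k`-norms.  The `C^k`-norm of a test function on `K` is measured through the derivatives of
smooth extensions `Φ` to the ambient space (this is the quotient topology, which is the usual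
topology defined with charts). -/
structure SubDistribution (M : Set F) extends SubTest M →ₗ[ℂ] ℂ where
  bound' : ∀ K : Set F, IsCompact K → K ⊆ M → ∃ (k : ℕ) (C : ℝ),
    ∀ φ : SubTest M, (∀ x : M, (x : F) ∉ K → (φ : M → ℂ) x = 0) →
      ∀ Φ : F → ℂ, ContDiff ℝ ∞ Φ → (∀ x : M, Φ x = (φ : M → ℂ) x) →
        ∀ B : ℝ, 0 ≤ B → (∀ i ≤ k, ∀ x ∈ K, ‖iteratedFDeriv ℝ i Φ x‖ ≤ B) →
          ‖toLinearMap φ‖ ≤ C * B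

end Subsets

/-- `S` is a (boundaryless) submanifold of `ℝⁿ` of codimension `d`, closed as a subset. -/
structure IsClosedSubmanifold {n : ℕ} (d : ℕ) (S : Set (Euc n)) : Prop where
  isClosed : IsClosed S
  exists_level : ∀ ξ ∈ S, ∃ U : Set (Euc n), IsOpen U ∧ ξ ∈ U ∧ ∃ F : Euc n → Euc d,
    ContDiffOn ℝ ∞ F U ∧ (∀ x ∈ U, Function.Surjective (fderiv ℝ F x)) ∧
      S ∩ U = {x ∈ U | F x = 0}

/-- The `ε`-neighbourhood `{x : ‖x - ξ‖ < ε(ξ) for some ξ ∈ S}` of `S`. -/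
def tube {n : ℕ} (S : Set (Euc n)) (ε : Euc n → ℝ) : Set (Euc n) :=
  {x | ∃ ξ ∈ S, ‖x - ξ‖ < ε ξ}

/-- `N 0, …, N (d-1)` is a smooth global frame of the normal bundle of `S`, orthonormal at each
point.  The tangent space of `S` at `ξ` is `tangentConeAt ℝ S ξ`.  Only the values of the `N k` on
`S` matter. -/
structure IsNormalFrame {n d : ℕ} (S : Set (Euc n)) (N : Fin d → Euc n → Euc n) : Prop where
  smooth : ∀ k, SmoothOnSubset S (N k)
  orthonormal : ∀ ξ ∈ S, Orthonormal ℝ (fun k => N k ξ)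
  mem_span_iff : ∀ ξ ∈ S, ∀ v : Euc n, v ∈ Submodule.span ℝ (range fun k => N k ξ) ↔
    ∀ w ∈ tangentConeAt ℝ S ξ, inner ℝ v w = 0

/-- `tube S ε` is a tubular neighbourhood of `S`: each of its points `x` has a unique closest point
`π x` in `S`, and `π : tube S ε → S` is a smooth submersion. -/
structure IsTubular {n : ℕ} (S : Set (Euc n)) (ε : Euc n → ℝ) (π : Euc n → Euc n) : Prop where
  eps_pos : ∀ ξ ∈ S, 0 < ε ξ
  eps_cont : ContinuousOn ε S
  proj_mem : ∀ x ∈ tube S ε, π x ∈ S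
  closest : ∀ x ∈ tube S ε, ∀ ζ ∈ S, ζ ≠ π x → ‖x - π x‖ < ‖x - ζ‖
  smooth : ContDiffOn ℝ ∞ π (tube S ε)
  submersion : ∀ x ∈ tube S ε, range (fderiv ℝ π x) = tangentConeAt ℝ S (π x)

/-- The geometric data: a closed submanifold of `ℝⁿ` of codimension `d`, together with a fixed
global smooth orthonormal normal frame and a fixed tubular neighbourhood. -/
structure FramedSubmanifold (n d : ℕ) where
  carrier : Set (Euc n)
  frame : Fin d → Euc n → Euc n
  eps : Euc n → ℝ
  proj : Euc n → Euc n
  isClosedSubmanifold : IsClosedSubmanifold d carrier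
  isNormalFrame : IsNormalFrame carrier frame
  isTubular : IsTubular carrier eps proj

namespace FramedSubmanifold

variable {n d : ℕ} (X : FramedSubmanifold n d) (Ω : TopologicalSpace.Opens (Euc n))

/-- The submanifold `Σ ∩ Ω`. -/
def base : Set (Euc n) := X.carrier ∩ Ω

/-- The submanifold `(Σ ∩ Ω) × 𝕊^{d-1}` of `ℝⁿ × ℝᵈ`. -/
def bundle : Set (Euc n × Euc d) := X.base Ω ×ˢ sphere 0 1

/-- The tube coordinate `ρ_x`. -/
noncomputable def rho (x : Euc n) : ℝ := ‖x - X.proj x‖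

/-- The tube coordinate `ω_x`. -/
noncomputable def omega (x : Euc n) : Euc d :=
  WithLp.toLp 2 fun k => inner ℝ (X.frame k (X.proj x)) (x - X.proj x) / X.rho x

/-- The points of `Ω` at which the tube coordinates are used; a neighbourhood of `Σ ∩ Ω` in `Ω`
that stays away from the boundary of the tubular neighbourhood. -/
def region : Set (Euc n) :=
  {x | x ∈ Ω ∧ x ∈ tube X.carrier X.eps ∧ X.rho x < X.eps (X.proj x) / 2 ∧ X.proj x ∈ Ω}

/-- The function `x ↦ a(ξ_x, ω_x) ρ_x^j`. -/
noncomputable def term (a : X.bundle Ω → ℂ) (j : ℤ) (x : Euc n) : ℂ :=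
  zeroExt (X.bundle Ω) a (X.proj x, X.omega x) * ((X.rho x ^ j : ℝ) : ℂ)

/-- The remainder `φ(x) - ∑_{m ≤ j < q} a_j(ξ_x, ω_x) ρ_x^j`. -/
noncomputable def remainder (m : ℤ) (φ : Euc n → ℂ) (a : ℤ → X.bundle Ω → ℂ) (q : ℤ)
    (x : Euc n) : ℂ :=
  φ x - ∑ j ∈ Finset.Ico m q, X.term Ω (a j) j x

/-- `φ` has the uniform strong asymptotic expansion `φ(x) ∼ ∑_{j ≥ m} a_j(ξ_x, ω_x) ρ_x^j` as
`ρ_x → 0`, with smooth coefficients `a_j` on `(Σ ∩ Ω) × 𝕊^{d-1}`: it can be differentiated term by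
term in `x` any number of times (the derivatives of order `i` of the `j`-th term are of size
`ρ_x^{j-i}`). -/
structure IsExpansion (m : ℤ) (φ : Euc n → ℂ) (a : ℤ → X.bundle Ω → ℂ) : Prop where
  smooth : ∀ j, SmoothOnSubset (X.bundle Ω) (zeroExt (X.bundle Ω) (a j))
  zero : ∀ j < m, a j = 0
  remainder_bound : ∀ (q : ℤ) (i : ℕ), ∃ C : ℝ, ∀ x ∈ X.region Ω \ X.carrier,
    ‖iteratedFDeriv ℝ i (X.remainder Ω m φ a q) x‖ ≤ C * X.rho x ^ (q - i)

lemma isOpen_tube {S : Set (Euc n)} {ε : Euc n → ℝ} : IsOpen (tube S ε) := by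
  have : tube S ε = ⋃ ξ ∈ S, ball ξ (ε ξ) := by
    ext x; simp [tube, dist_eq_norm]
  rw [this]
  exact isOpen_biUnion fun _ _ => isOpen_ball

variable {X} in
lemma inner_eq_zero {x : Euc n} (hx : x ∈ tube X.carrier X.eps) :
    ∀ w ∈ tangentConeAt ℝ X.carrier (X.proj x), inner ℝ (x - X.proj x) w = 0 := by
  intro w hw
  rw [← X.isTubular.submersion x hx] at hw
  obtain ⟨u, rfl⟩ := hw
  have hd : HasFDerivAt X.proj (fderiv ℝ X.proj x) x :=
    ((X.isTubular.smooth.contDiffAt (isOpen_tube.mem_nhds hx)).differentiableAt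
      (by simp)).hasFDerivAt
  have h1 := (hd.const_sub x).norm_sq
  have hmin : IsLocalMin (fun z => ‖x - X.proj z‖ ^ 2) x := by
    filter_upwards [isOpen_tube.mem_nhds hx] with z hz
    by_cases h : X.proj z = X.proj x
    · rw [h]
    · have := X.isTubular.closest x hx _ (X.isTubular.proj_mem z hz) h
      gcongr
  have h2 := hmin.hasFDerivAt_eq_zero h1
  have h3 := congrArg (fun L => L u) h2
  simp at h3
  rw [inner_sub_left]
  linarith

variable {X} in
lemma rho_pos {x : Euc n} (hx : x ∈ tube X.carrier X.eps) (hS : x ∉ X.carrier) : 0 < X.rho x := by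
  rw [rho, norm_pos_iff, sub_ne_zero]
  rintro h
  exact hS (h ▸ X.isTubular.proj_mem x hx)

variable {X} in
/-- The coordinate `ω_x` is a unit vector. -/
lemma omega_mem {x : Euc n} (hx : x ∈ tube X.carrier X.eps) (hS : x ∉ X.carrier) :
    X.omega x ∈ sphere (0 : Euc d) 1 := by
  have hp := X.isTubular.proj_mem x hx
  have ho := X.isNormalFrame.orthonormal _ hp
  have hsp := (X.isNormalFrame.mem_span_iff _ hp _).2 (inner_eq_zero hx)
  obtain ⟨c, hc⟩ := (Submodule.mem_span_range_iff_exists_fun ℝ).1 hsp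
  have hr := rho_pos hx hS
  have hin : ∀ k, inner ℝ (X.frame k (X.proj x)) (x - X.proj x) = c k := by
    intro k
    rw [← hc]
    exact ho.inner_right_fintype c k
  have hn : X.rho x ^ 2 = ∑ k, c k ^ 2 := by
    rw [rho, ← real_inner_self_eq_norm_sq]
    nth_rw 1 [← hc]
    rw [sum_inner]
    refine Finset.sum_congr rfl fun k _ => ?_
    rw [real_inner_smul_left, hin, sq]
  rw [mem_sphere_zero_iff_norm, EuclideanSpace.norm_eq, Real.sqrt_eq_one]
  simp only [omega, hin, Real.norm_eq_abs, sq_abs, div_pow]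
  rw [← Finset.sum_div, ← hn, div_self (by positivity)]

variable {X} in
lemma eventually_mem_bundle {x : Euc n} (hx : x ∈ X.region Ω \ X.carrier) :
    ∀ᶠ y in 𝓝 x, (X.proj y, X.omega y) ∈ X.bundle Ω := by
  obtain ⟨⟨-, ht, -, hp⟩, hS⟩ := hx
  have hc : ContinuousAt X.proj x :=
    (X.isTubular.smooth.contDiffAt (isOpen_tube.mem_nhds ht)).continuousAt
  filter_upwards [isOpen_tube.mem_nhds ht,
    X.isClosedSubmanifold.isClosed.isOpen_compl.mem_nhds hS,
    hc.preimage_mem_nhds (Ω.isOpen.mem_nhds hp)] with y hy hyS hyp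
  exact ⟨⟨X.isTubular.proj_mem y hy, hyp⟩, omega_mem hy hyS⟩

variable {X Ω} in
lemma contDiffAt_term {a : X.bundle Ω → ℂ}
    (ha : SmoothOnSubset (X.bundle Ω) (zeroExt (X.bundle Ω) a)) (j : ℤ) {x : Euc n}
    (hx : x ∈ X.region Ω \ X.carrier) : ContDiffAt ℝ ∞ (X.term Ω a j) x := by
  have hev := eventually_mem_bundle Ω hx
  obtain ⟨⟨-, ht, -, hp⟩, hS⟩ := hx
  have htn := isOpen_tube.mem_nhds ht
  have hπ : ContDiffAt ℝ ∞ X.proj x := X.isTubular.smooth.contDiffAt htn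
  have hr := rho_pos ht hS
  have hsub : ContDiffAt ℝ ∞ (fun y => y - X.proj y) x := contDiffAt_id.sub hπ
  have hρ : ContDiffAt ℝ ∞ X.rho x := hsub.norm ℝ (norm_pos_iff.1 hr)
  have hN : ∀ k, ContDiffAt ℝ ∞ (fun y => X.frame k (X.proj y)) x := by
    intro k
    obtain ⟨N', hN', he⟩ := X.isNormalFrame.smooth k _ (X.isTubular.proj_mem x ht)
    have hten : Tendsto X.proj (𝓝 x) (𝓝[X.carrier] (X.proj x)) :=
      tendsto_nhdsWithin_iff.2 ⟨hπ.continuousAt, by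
        filter_upwards [htn] with y hy using X.isTubular.proj_mem y hy⟩
    exact (hN'.contDiffAt.comp x hπ).congr_of_eventuallyEq (he.comp_tendsto hten)
  have hω : ContDiffAt ℝ ∞ X.omega x := by
    rw [contDiffAt_euclidean]
    intro k
    exact ((hN k).inner ℝ hsub).div hρ hr.ne'
  have hpair : ContDiffAt ℝ ∞ (fun y => (X.proj y, X.omega y)) x := hπ.prodMk hω
  obtain ⟨A, hA, he⟩ := ha (X.proj x, X.omega x) hev.self_of_nhds
  have hten : Tendsto (fun y => (X.proj y, X.omega y)) (𝓝 x)
      (𝓝[X.bundle Ω] (X.proj x, X.omega x)) :=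
    tendsto_nhdsWithin_iff.2 ⟨hpair.continuousAt, hev⟩
  have h1 : ContDiffAt ℝ ∞ (fun y => zeroExt (X.bundle Ω) a (X.proj y, X.omega y)) x :=
    (hA.contDiffAt.comp x hpair).congr_of_eventuallyEq (he.comp_tendsto hten)
  have h2 : ContDiffAt ℝ ∞ (fun y => X.rho y ^ j) x := by
    rcases j with j | j
    · simpa using hρ.pow j
    · simp only [zpow_negSucc]
      exact (hρ.pow (j + 1)).inv (by positivity)
  exact h1.mul (Complex.ofRealCLM.contDiff.contDiffAt.comp x h2)

/-- The space `𝓓_{*,Σ}(Ω)` of thick test functions: smooth functions on `Ω \ Σ` that vanish outside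
a compact subset `K` of `Ω` and have a strong asymptotic expansion along `Σ`.  As a function on
`ℝⁿ`, an element of this space is extended by zero to the points of `Σ` and outside `Ω`. -/
def IsThickTest (φ : Euc n → ℂ) : Prop :=
  ContDiffOn ℝ ∞ φ (Ω \ X.carrier) ∧ (∀ x ∈ X.carrier, φ x = 0) ∧
    (∃ K : Set (Euc n), IsCompact K ∧ K ⊆ Ω ∧ ∀ x ∉ K, φ x = 0) ∧
    ∃ m a, X.IsExpansion Ω m φ a

variable {X Ω}

lemma contDiffAt_of_region {φ : Euc n → ℂ} (h : ContDiffOn ℝ ∞ φ (Ω \ X.carrier)) {x : Euc n}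
    (hx : x ∈ X.region Ω \ X.carrier) : ContDiffAt ℝ ∞ φ x :=
  h.contDiffAt ((Ω.isOpen.sdiff X.isClosedSubmanifold.isClosed).mem_nhds ⟨hx.1.1, hx.2⟩)

lemma contDiffAt_remainder {m : ℤ} {φ : Euc n → ℂ} {a : ℤ → X.bundle Ω → ℂ}
    (h : ContDiffOn ℝ ∞ φ (Ω \ X.carrier))
    (ha : ∀ j, SmoothOnSubset (X.bundle Ω) (zeroExt (X.bundle Ω) (a j))) (q : ℤ) {x : Euc n}
    (hx : x ∈ X.region Ω \ X.carrier) : ContDiffAt ℝ ∞ (X.remainder Ω m φ a q) x :=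
  (contDiffAt_of_region h hx).sub (ContDiffAt.sum fun j _ => contDiffAt_term (ha j) j hx)

lemma term_zero (j : ℤ) : X.term Ω 0 j = 0 := by
  funext x; simp [term, zeroExt_zero]

lemma IsExpansion.mono {m m' : ℤ} (hm : m' ≤ m) {φ : Euc n → ℂ} {a : ℤ → X.bundle Ω → ℂ}
    (h : X.IsExpansion Ω m φ a) : X.IsExpansion Ω m' φ a := by
  refine ⟨h.smooth, fun j hj => h.zero j (by lia), fun q i => ?_⟩
  have : X.remainder Ω m' φ a q = X.remainder Ω m φ a q := by
    funext x
    unfold remainder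
    congr 1
    symm
    refine Finset.sum_subset (Finset.Ico_subset_Ico_left hm) fun j hj hj' => ?_
    have : j < m := by simp at hj hj'; lia
    rw [h.zero j this, term_zero, Pi.zero_apply]
  rw [this]
  exact h.remainder_bound q i

lemma IsExpansion.add {m : ℤ} {φ ψ : Euc n → ℂ} {a b : ℤ → X.bundle Ω → ℂ}
    (hφ : ContDiffOn ℝ ∞ φ (Ω \ X.carrier)) (hψ : ContDiffOn ℝ ∞ ψ (Ω \ X.carrier))
    (h : X.IsExpansion Ω m φ a) (h' : X.IsExpansion Ω m ψ b) :
    X.IsExpansion Ω m (φ + ψ) (a + b) := by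
  refine ⟨fun j => ?_, fun j hj => ?_, fun q i => ?_⟩
  · rw [Pi.add_apply, zeroExt_add]
    exact (h.smooth j).add (h'.smooth j)
  · rw [Pi.add_apply, h.zero j hj, h'.zero j hj, add_zero]
  · obtain ⟨C, hC⟩ := h.remainder_bound q i
    obtain ⟨C', hC'⟩ := h'.remainder_bound q i
    refine ⟨C + C', fun x hx => ?_⟩
    have : X.remainder Ω m (φ + ψ) (a + b) q =
        X.remainder Ω m φ a q + X.remainder Ω m ψ b q := by
      funext y
      simp only [remainder, term, Pi.add_apply, zeroExt_add, add_mul, Finset.sum_add_distrib]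
      ring
    rw [this, iteratedFDeriv_add_apply
      ((contDiffAt_remainder hφ h.smooth q hx).of_le (by exact_mod_cast le_top))
      ((contDiffAt_remainder hψ h'.smooth q hx).of_le (by exact_mod_cast le_top))]
    calc _ ≤ _ := norm_add_le _ _
      _ ≤ _ := add_le_add (hC x hx) (hC' x hx)
      _ = _ := by ring

lemma IsExpansion.smul {m : ℤ} {φ : Euc n → ℂ} {a : ℤ → X.bundle Ω → ℂ} (c : ℂ)
    (hφ : ContDiffOn ℝ ∞ φ (Ω \ X.carrier))
    (h : X.IsExpansion Ω m φ a) : X.IsExpansion Ω m (c • φ) (c • a) := by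
  refine ⟨fun j => ?_, fun j hj => ?_, fun q i => ?_⟩
  · rw [Pi.smul_apply, zeroExt_smul]
    exact (h.smooth j).smul c
  · rw [Pi.smul_apply, h.zero j hj, smul_zero]
  · obtain ⟨C, hC⟩ := h.remainder_bound q i
    refine ⟨‖c‖ * C, fun x hx => ?_⟩
    have : X.remainder Ω m (c • φ) (c • a) q = c • X.remainder Ω m φ a q := by
      funext y
      simp only [remainder, term, Pi.smul_apply, zeroExt_smul, smul_eq_mul, mul_sub,
        Finset.mul_sum, mul_assoc]
    rw [this, iteratedFDeriv_const_smul_apply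
      ((contDiffAt_remainder hφ h.smooth q hx).of_le (by exact_mod_cast le_top)), norm_smul,
      mul_assoc]
    gcongr
    exact hC x hx

lemma IsExpansion.zero' : X.IsExpansion Ω 0 0 0 := by
  refine ⟨fun j => ?_, fun j _ => rfl, fun q i => ⟨0, fun x _ => ?_⟩⟩
  · rw [Pi.zero_apply, zeroExt_zero]
    exact SmoothOnSubset.zero
  · have : X.remainder Ω 0 0 0 q = 0 := by
      funext y
      simp [remainder, term_zero]
    simp [this]

variable (X Ω)

/-- The vector space `𝓓_{*,Σ}(Ω)`. -/
def ThickTest : Submodule ℂ (Euc n → ℂ) where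
  carrier := {φ | X.IsThickTest Ω φ}
  add_mem' := by
    rintro φ ψ ⟨h1, h2, ⟨K, hK, hKΩ, hK0⟩, m, a, ha⟩ ⟨h1', h2', ⟨K', hK', hKΩ', hK0'⟩, m', a', ha'⟩
    refine ⟨h1.add h1', fun x hx => by simp [h2 x hx, h2' x hx],
      ⟨K ∪ K', hK.union hK', union_subset hKΩ hKΩ', fun x hx => ?_⟩, min m m', a + a',
      (ha.mono (min_le_left _ _)).add h1 h1' (ha'.mono (min_le_right _ _))⟩
    simp only [mem_union, not_or] at hx
    simp [hK0 x hx.1, hK0' x hx.2]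
  zero_mem' := ⟨contDiffOn_const, fun _ _ => rfl, ⟨∅, isCompact_empty, empty_subset _,
    fun _ _ => rfl⟩, 0, 0, IsExpansion.zero'⟩
  smul_mem' := by
    rintro c φ ⟨h1, h2, ⟨K, hK, hKΩ, hK0⟩, m, a, ha⟩
    exact ⟨contDiffOn_const.smul h1, fun x hx => by simp [h2 x hx],
      ⟨K, hK, hKΩ, fun x hx => by simp [hK0 x hx]⟩, m, c • a, ha.smul c h1⟩

/-- The space `𝓓'_{*,Σ}(Ω)` of thick distributions: linear functionals on `𝓓_{*,Σ}(Ω)` whose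
restriction to each step `𝓓^{[m;K]}_{*,Σ}(Ω)` (thick test functions that vanish outside `K` and
have an expansion starting at `j = m`) is continuous.  The topology of the step is given by the
weighted sup-norms of the derivatives of the remainders of the expansion near `Σ`, and the sup-norms
of the derivatives of the function on the rest of `K`. -/
structure ThickDistribution extends X.ThickTest Ω →ₗ[ℂ] ℂ where
  bound' : ∀ (m : ℤ) (K : Set (Euc n)), IsCompact K → K ⊆ Ω → ∃ (q : ℤ) (k : ℕ) (C : ℝ),
    ∀ φ : X.ThickTest Ω, (∀ x ∉ K, (φ : Euc n → ℂ) x = 0) →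
      ∀ a, X.IsExpansion Ω m φ a → ∀ B : ℝ, 0 ≤ B →
        (∀ p ∈ Icc m q, ∀ i ≤ k, ∀ x ∈ X.region Ω \ X.carrier,
          ‖iteratedFDeriv ℝ i (X.remainder Ω m φ a p) x‖ ≤ B * X.rho x ^ (p - i)) →
        (∀ i ≤ k, ∀ x ∈ K \ X.region Ω, ‖iteratedFDeriv ℝ i (φ : Euc n → ℂ) x‖ ≤ B) →
          ‖toLinearMap φ‖ ≤ C * B

/-- The surface measure `|𝕊^{d-1}|` of the unit sphere of `ℝᵈ`. -/
noncomputable def sphereArea (d : ℕ) : ℝ :=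
  (MeasureTheory.volume : MeasureTheory.Measure (Euc d)).toSphere.real univ

variable {X Ω}

/-- `T` is the thick delta function `g δ_{*,Σ}^{[j]}` of degree `j`:
`⟨T, φ⟩ = |𝕊^{d-1}|⁻¹ ⟨g, a_j⟩` for every thick test function `φ ∼ ∑ a_j ρ^j` (where `a_j` is an
element of `𝓓((Σ ∩ Ω) × 𝕊^{d-1})`). -/
def IsThickDelta (g : SubDistribution (X.bundle Ω)) (j : ℤ) (T : X.ThickDistribution Ω) : Prop :=
  ∀ (φ : X.ThickTest Ω) (m : ℤ) (a : ℤ → X.bundle Ω → ℂ), X.IsExpansion Ω m φ a →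
    ∃ b : SubTest (X.bundle Ω), (b : X.bundle Ω → ℂ) = a j ∧
      T.toLinearMap φ = (sphereArea d : ℂ)⁻¹ * g.toLinearMap b

/-- `P = Π(T)`, where `Π : 𝓓'_{*,Σ}(Ω) → 𝓓'(Ω)` is the transpose of the inclusion
`𝓓(Ω) → 𝓓_{*,Σ}(Ω)`, `φ ↦ φ|_{Ω \ Σ}`. -/
def IsProjection (T : X.ThickDistribution Ω) (P : 𝓓(Ω, ℂ) →L[ℂ] ℂ) : Prop :=
  ∀ φ : 𝓓(Ω, ℂ), ∃ ψ : X.ThickTest Ω, (ψ : Euc n → ℂ) = X.carrierᶜ.indicator φ ∧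
    P φ = T.toLinearMap ψ

/-- The product `χ(ξ) ω^α` on `(Σ ∩ Ω) × 𝕊^{d-1}`. -/
noncomputable def mulMonomial (α : Fin d → ℕ) (χ : X.base Ω → ℂ) : X.bundle Ω → ℂ :=
  fun p => χ ⟨p.1.1, p.2.1⟩ * ∏ k, ((p.1.2 k : ℝ) : ℂ) ^ α k

lemma mulMonomial_mem (α : Fin d → ℕ) (χ : SubTest (X.base Ω)) :
    mulMonomial α (χ : X.base Ω → ℂ) ∈ SubTest (X.bundle Ω) := by
  obtain ⟨χ, hs, hc⟩ := χ
  refine ⟨fun p hp => ?_, ?_⟩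
  · obtain ⟨f, hf, he⟩ := hs p.1 hp.1
    refine ⟨fun p => f p.1 * ∏ k, ((p.2 k : ℝ) : ℂ) ^ α k, ?_, ?_⟩
    · refine (hf.comp contDiff_fst).mul (contDiff_prod fun k _ => ?_)
      have h1 : ContDiff ℝ ∞ fun p : Euc n × Euc d => p.2 k :=
        (contDiff_euclidean.1 contDiff_snd) k
      exact (Complex.ofRealCLM.contDiff.comp h1).pow _
    · have hten : Tendsto Prod.fst (𝓝[X.bundle Ω] p) (𝓝[X.base Ω] p.1) :=
        tendsto_nhdsWithin_iff.2 ⟨continuous_fst.continuousAt.mono_left nhdsWithin_le_nhds,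
          by filter_upwards [self_mem_nhdsWithin] with y hy using hy.1⟩
      filter_upwards [he.comp_tendsto hten, self_mem_nhdsWithin] with y hy hyM
      rw [← show zeroExt (X.base Ω) χ y.1 = f y.1 from hy, zeroExt_of_mem _ hyM,
        zeroExt_of_mem _ hyM.1]
      rfl
  · let e : X.base Ω × sphere (0 : Euc d) 1 → X.bundle Ω := fun q => ⟨(q.1, q.2), q.1.2, q.2.2⟩
    have hcont : Continuous e := by fun_prop
    refine HasCompactSupport.intro
      ((hc.isCompact.prod (isCompact_univ (X := sphere (0 : Euc d) 1))).image hcont) fun p hp => ?_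
    have : (⟨p.1.1, p.2.1⟩ : X.base Ω) ∉ tsupport χ := fun h =>
      hp ⟨(⟨p.1.1, p.2.1⟩, ⟨p.1.2, p.2.2⟩), ⟨h, mem_univ _⟩, rfl⟩
    simp [mulMonomial, image_eq_zero_of_notMem_tsupport this]

lemma contDiff_monomial (α : Fin d → ℕ) :
    ContDiff ℝ ∞ fun p : Euc n × Euc d => ∏ k, ((p.2 k : ℝ) : ℂ) ^ α k := by
  refine contDiff_prod fun k _ => ?_
  have h1 : ContDiff ℝ ∞ fun p : Euc n × Euc d => p.2 k :=
    (contDiff_euclidean.1 contDiff_snd) k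
  exact (Complex.ofRealCLM.contDiff.comp h1).pow _

/-- The distribution `h_α(ξ) = ⟨g(ξ, ω), ω^α⟩` on `Σ ∩ Ω`: `⟨h_α, χ⟩ = ⟨g, χ(ξ) ω^α⟩`. -/
noncomputable def angularMoment (g : SubDistribution (X.bundle Ω)) (α : Fin d → ℕ) :
    SubDistribution (X.base Ω) where
  toFun χ := g.toLinearMap ⟨mulMonomial α χ, mulMonomial_mem α χ⟩
  map_add' χ χ' := by
    rw [← map_add]
    congr 1
    ext p
    simp [mulMonomial, add_mul]
  map_smul' c χ := by
    rw [RingHom.id_apply, ← map_smul]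
    congr 1
    ext p
    simp [mulMonomial, mul_assoc]
  bound' := by
    intro K hK hKM
    have hK' : IsCompact (K ×ˢ sphere (0 : Euc d) 1) := hK.prod (isCompact_sphere 0 1)
    obtain ⟨k, C, hC⟩ := g.bound' _ hK' (prod_mono hKM subset_rfl)
    have hP := contDiff_monomial (n := n) α
    have hD : ∀ i : ℕ, ∃ D : ℝ, 0 ≤ D ∧ ∀ p ∈ K ×ˢ sphere (0 : Euc d) 1,
        ‖iteratedFDeriv ℝ i (fun p : Euc n × Euc d => ∏ k, ((p.2 k : ℝ) : ℂ) ^ α k) p‖ ≤ D := by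
      intro i
      obtain ⟨D, hD⟩ := hK'.exists_bound_of_continuousOn
        (hP.continuous_iteratedFDeriv (m := i) (by exact_mod_cast le_top)).continuousOn
      exact ⟨max D 0, le_max_right _ _, fun p hp => (hD p hp).trans (le_max_left _ _)⟩
    choose D hD0 hD using hD
    set E : ℝ := ∑ i ∈ Finset.range (k + 1), D i with hE
    have hDE : ∀ i ≤ k, D i ≤ E := fun i hi =>
      Finset.single_le_sum (f := D) (fun i _ => hD0 i) (Finset.mem_range.2 (by lia))
    have hE0 : 0 ≤ E := Finset.sum_nonneg fun i _ => hD0 i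
    refine ⟨k, C * (2 ^ k * E), fun χ hχ Φ hΦ hΦχ B hB hbd => ?_⟩
    have key := hC ⟨mulMonomial α χ, mulMonomial_mem α χ⟩ (fun p hp => ?_)
      (fun p => Φ p.1 * ∏ k, ((p.2 k : ℝ) : ℂ) ^ α k) ((hΦ.comp contDiff_fst).mul hP)
      (fun p => ?_) (2 ^ k * E * B) (by positivity) (fun i hi p hp => ?_)
    · refine key.trans (le_of_eq (by ring))
    · have : (p.1.1 : Euc n) ∉ K := fun h => hp ⟨h, p.2.2⟩
      simp [mulMonomial, hχ ⟨p.1.1, p.2.1⟩ this]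
    · have := hΦχ ⟨p.1.1, p.2.1⟩
      simp only at this
      simp [mulMonomial, this]
    · refine (norm_iteratedFDeriv_mul_le (hΦ.comp contDiff_fst) hP p
        (n := i) (by exact_mod_cast le_top)).trans ?_
      have h1 : ∀ l ∈ Finset.range (i + 1), (i.choose l : ℝ) *
          ‖iteratedFDeriv ℝ l (Φ ∘ Prod.fst) p‖ * ‖iteratedFDeriv ℝ (i - l)
            (fun p : Euc n × Euc d => ∏ k, ((p.2 k : ℝ) : ℂ) ^ α k) p‖ ≤ i.choose l * (B * E) := by
        intro l hl
        have hl' : l ≤ k := by have := Finset.mem_range.1 hl; lia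
        rw [mul_assoc]
        gcongr
        · have h2 := ContinuousLinearMap.iteratedFDeriv_comp_right
            (ContinuousLinearMap.fst ℝ (Euc n) (Euc d)) hΦ p (i := l) (by exact_mod_cast le_top)
          have h3 : ‖iteratedFDeriv ℝ l (Φ ∘ (ContinuousLinearMap.fst ℝ (Euc n) (Euc d))) p‖ ≤
              ‖iteratedFDeriv ℝ l Φ p.1‖ := by
            rw [h2]
            refine (ContinuousMultilinearMap.norm_compContinuousLinearMap_le _ _).trans ?_
            refine mul_le_of_le_one_right (norm_nonneg _) ?_
            exact Finset.prod_le_one (fun _ _ => norm_nonneg _)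
              fun _ _ => ContinuousLinearMap.norm_fst_le ℝ (Euc n) (Euc d)
          exact h3.trans (hbd l hl' p.1 hp.1)
        · exact (hD _ p hp).trans (hDE _ (by lia))
      refine (Finset.sum_le_sum h1).trans ?_
      rw [← Finset.sum_mul]
      have h4 : (∑ l ∈ Finset.range (i + 1), (i.choose l : ℝ)) = 2 ^ i := by
        exact_mod_cast Nat.sum_range_choose i
      rw [h4]
      have h5 : (2 : ℝ) ^ i ≤ 2 ^ k := pow_le_pow_right₀ (by norm_num) hi
      nlinarith [mul_nonneg hB hE0]

end FramedSubmanifold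

/-- The partial derivative `∂f/∂y_k` of a function on `ℝᵈ`. -/
noncomputable def partialDeriv {d : ℕ} (k : Fin d) (f : Euc d → ℂ) : Euc d → ℂ :=
  fun y => fderiv ℝ f y (EuclideanSpace.single k 1)

/-- The iterated partial derivative `∂^α f/∂y^α` of a function on `ℝᵈ`. -/
noncomputable def mixedPartial {d : ℕ} (α : Fin d → ℕ) (f : Euc d → ℂ) : Euc d → ℂ :=
  (List.finRange d).foldr (fun k h => (partialDeriv k)^[α k] h) f

section MixedPartial

variable {n d : ℕ}

lemma contDiff_partialDeriv (k : Fin d) {H : Euc n → Euc d → ℂ}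
    (hH : ContDiff ℝ ∞ (Function.uncurry H)) :
    ContDiff ℝ ∞ (Function.uncurry fun x => partialDeriv k (H x)) := by
  have h : ContDiff ℝ ∞ (fun p : Euc n × Euc d => fderiv ℝ (H p.1) p.2) :=
    ContDiff.fderiv (f := fun p : Euc n × Euc d => H p.1)
      (hH.comp ((contDiff_fst.comp contDiff_fst).prodMk contDiff_snd)) contDiff_snd (by simp)
  exact h.clm_apply contDiff_const

lemma contDiff_mixedPartial (α : Fin d → ℕ) {H : Euc n → Euc d → ℂ}
    (hH : ContDiff ℝ ∞ (Function.uncurry H)) :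
    ContDiff ℝ ∞ (Function.uncurry fun x => mixedPartial α (H x)) := by
  unfold mixedPartial
  induction List.finRange d with
  | nil => exact hH
  | cons k l ih =>
    simp only [List.foldr_cons]
    induction α k with
    | zero => exact ih
    | succ r ihr =>
      simp only [Function.iterate_succ_apply']
      exact contDiff_partialDeriv k ihr

lemma mixedPartial_eventuallyEq_zero (α : Fin d → ℕ) {f : Euc d → ℂ} {y : Euc d}
    (hf : f =ᶠ[𝓝 y] 0) : mixedPartial α f =ᶠ[𝓝 y] 0 := by
  unfold mixedPartial
  induction List.finRange d with
  | nil => exact hf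
  | cons k l ih =>
    simp only [List.foldr_cons]
    induction α k with
    | zero => exact ih
    | succ r ihr =>
      simp only [Function.iterate_succ_apply']
      filter_upwards [ihr.fderiv (𝕜 := ℝ)] with z hz
      simp only [partialDeriv]
      rw [hz]
      simp

end MixedPartial

namespace FramedSubmanifold

variable {n d : ℕ} {X : FramedSubmanifold n d} {Ω : TopologicalSpace.Opens (Euc n)}

variable (X Ω) in
/-- The derivative `D_𝐧^α φ(ξ) = ∂^α/∂y^α φ(ξ + ∑ₖ yₖ 𝐧ₖ(ξ))` at `y = 0`, a function on
`Σ ∩ Ω`. -/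
noncomputable def normalDeriv (α : Fin d → ℕ) (φ : Euc n → ℂ) : X.base Ω → ℂ :=
  fun ξ => mixedPartial α (fun y : Euc d => φ (ξ + ∑ k, y k • X.frame k ξ)) 0

lemma normalDeriv_mem (α : Fin d → ℕ) (φ : 𝓓(Ω, ℂ)) :
    X.normalDeriv Ω α φ ∈ SubTest (X.base Ω) := by
  refine ⟨fun ξ hξ => ?_, ?_⟩
  · choose N' hN' he using fun k => X.isNormalFrame.smooth k ξ hξ.1
    have hφ : ContDiff ℝ ∞ φ := φ.contDiff
    have hy : ∀ k, ContDiff ℝ ∞ fun p : Euc n × Euc d => p.2 k := fun k =>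
      (contDiff_euclidean.1 contDiff_snd) k
    have hH : ContDiff ℝ ∞ (Function.uncurry fun (x : Euc n) (y : Euc d) =>
        φ (x + ∑ k, y k • N' k x)) :=
      hφ.comp (contDiff_fst.add (ContDiff.sum fun k _ =>
        (hy k).smul ((hN' k).comp contDiff_fst)))
    refine ⟨fun x => mixedPartial α (fun y : Euc d => φ (x + ∑ k, y k • N' k x)) 0,
      (contDiff_mixedPartial α hH).comp (contDiff_id.prodMk contDiff_const), ?_⟩
    have he' : ∀ᶠ x in 𝓝[X.base Ω] ξ, ∀ k, X.frame k x = N' k x :=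
      eventually_all.2 fun k => (he k).filter_mono (nhdsWithin_mono _ inter_subset_left)
    filter_upwards [he', self_mem_nhdsWithin] with x hx hxM
    rw [zeroExt_of_mem _ hxM]
    simp only [normalDeriv, hx]
  · have hK : IsCompact {ξ : X.base Ω | (ξ : Euc n) ∈ tsupport φ} := by
      rw [Subtype.isCompact_iff]
      have : ((↑) : X.base Ω → Euc n) '' {ξ | (ξ : Euc n) ∈ tsupport φ} =
          tsupport φ ∩ X.carrier := by
        ext x
        constructor
        · rintro ⟨y, hy, rfl⟩
          exact ⟨hy, y.2.1⟩
        · rintro ⟨hx, hxS⟩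
          exact ⟨⟨x, hxS, φ.tsupport_subset hx⟩, hx, rfl⟩
      rw [this]
      exact φ.hasCompactSupport.isCompact.inter_right X.isClosedSubmanifold.isClosed
    refine HasCompactSupport.intro hK fun ξ hξ => ?_
    have h0 : (φ : Euc n → ℂ) =ᶠ[𝓝 (ξ : Euc n)] 0 := notMem_tsupport_iff_eventuallyEq.1 hξ
    have hten : Tendsto (fun y : Euc d => (ξ : Euc n) + ∑ k, y k • X.frame k ξ) (𝓝 0)
        (𝓝 (ξ : Euc n)) := by
      have hcont : Continuous fun y : Euc d => (ξ : Euc n) + ∑ k, y k • X.frame k ξ := by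
        fun_prop
      simpa using hcont.tendsto 0
    exact (mixedPartial_eventuallyEq_zero α (h0.comp_tendsto hten)).self_of_nhds

/-- `P = D̄_𝐧^α(h δ_Σ)`, the multilayer along `Σ`:
`⟨D̄_𝐧^α(h δ_Σ), φ⟩ = (-1)^{|α|} ⟨h, D_𝐧^α φ⟩` for all `φ ∈ 𝓓(Ω)`. -/
def IsMultilayer (h : SubDistribution (X.base Ω)) (α : Fin d → ℕ) (P : 𝓓(Ω, ℂ) →L[ℂ] ℂ) : Prop :=
  ∀ φ : 𝓓(Ω, ℂ), P φ = (-1) ^ (∑ k, α k) * h.toLinearMap ⟨X.normalDeriv Ω α φ, normalDeriv_mem α φ⟩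

end FramedSubmanifold

end ThickDist

namespace ThickDist

/-! In tube coordinates a point near the submanifold is `ξ + ρ ∑ ωₖ 𝐧ₖ(ξ)`. Taylor's formula in the
normal slice at `ξ`, grouped by the multinomial theorem, therefore expands a smooth `φ` as `∑ⱼ ρ^j
∑_{|α|=j} D_𝐧^α φ(ξ) ω^α / α!`. Once this is known to be a strong expansion and coefficients are
known to be unique, the `j`-th coefficient of `φ` is the inner sum. Pairing it with `g` produces
`⟨h_α, D_𝐧^α φ⟩ / α!`, and the sign `(-1)^j` in the formula cancels the sign of the multilayer.

The analytic core is that the Taylor remainder may be differentiated. The remainder of order `q` is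
smooth on the whole tube, the submanifold included, and is `O(ρ^q)`. Since `ρ_x ≤ ‖x - ξ‖` for every
`ξ` in the submanifold, all its derivatives of order `< q` vanish there
(`iteratedFDeriv_taylorRemainder_eq_zero`). Integrating the `q`-th derivative along the segment from
`π(x)` to `x` makes the `i`-th derivative `O(ρ^(q-i))`; the constant is uniform because the relevant
segments fill a compact part of the tube (`exists_isCompact_segment_subset`).

For well-definedness, a short normal segment has the expected tube coordinates
(`exists_normalPoint_mem_region`), so an expansion restricts on it to a one-variable expansion in
`t`, whose coefficients are unique. Continuity of the thick delta (`exists_bound_coeff`) comes from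
reading `a_j` off its term at a fixed radius `t₀`, the term being a difference of two consecutive
remainders. Continuity of multilayers (`exists_bound_normalDeriv`) comes from extending `D_𝐧^α φ`
smoothly to the ambient space. -/

lemma natCast_lt_infty (l : ℕ) : (l : ℕ∞ω) < ∞ :=
  WithTop.coe_lt_coe.2 (ENat.natCast_lt_top l)

/-! ### Symmetry of derivatives, Taylor's formula and order of vanishing -/

section SmoothFunctions

variable {E : Type*} [NormedAddCommGroup E] [NormedSpace ℝ E]

variable (E) in
/-- The space of complex-valued smooth functions on a normed space. -/
def SmoothFun : Submodule ℝ (E → ℂ) where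
  carrier := {f | ContDiff ℝ ∞ f}
  add_mem' {f g} hf hg := by
    have hf' : ContDiff ℝ ∞ f := hf
    exact hf'.add hg
  zero_mem' := by
    change ContDiff ℝ ∞ fun _ => (0 : ℂ)
    exact contDiff_const
  smul_mem' c f hf := by
    have hf' : ContDiff ℝ ∞ f := hf
    exact contDiff_const.smul hf'

lemma contDiff_smoothFun (f : SmoothFun E) : ContDiff ℝ ∞ (f : E → ℂ) := f.2

lemma differentiableAt_smoothFun (f : SmoothFun E) (x : E) :
    DifferentiableAt ℝ (f : E → ℂ) x :=
  (contDiff_smoothFun f).contDiffAt.differentiableAt (by simp)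

/-- The derivative in the direction `v`, as an operator on smooth functions. -/
noncomputable def dirDeriv (v : E) : Module.End ℝ (SmoothFun E) where
  toFun f := ⟨fun x => fderiv ℝ (f : E → ℂ) x v, by
    have h : ContDiff ℝ ∞ fun x => fderiv ℝ (f : E → ℂ) x v :=
      ((contDiff_smoothFun f).fderiv_right (m := ∞) (by simp)).clm_apply contDiff_const
    exact h⟩
  map_add' f g := by
    ext x
    simp [fderiv_add (differentiableAt_smoothFun f x) (differentiableAt_smoothFun g x)]
  map_smul' c f := by
    ext x
    simp [fderiv_const_smul (differentiableAt_smoothFun f x)]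

lemma dirDeriv_apply (v : E) (f : SmoothFun E) (x : E) :
    (dirDeriv v f : E → ℂ) x = fderiv ℝ f x v := rfl

lemma dirDeriv_commute (v w : E) : Commute (dirDeriv v) (dirDeriv w) := by
  ext f x
  have h2 : ContDiffAt ℝ ∞ (f : E → ℂ) x := (contDiff_smoothFun f).contDiffAt
  have hs : IsSymmSndFDerivAt ℝ (f : E → ℂ) x := h2.isSymmSndFDerivAt (by
    rw [minSmoothness_of_isRCLikeNormedField]
    exact (natCast_lt_infty 2).le)
  have hd : DifferentiableAt ℝ (fderiv ℝ (f : E → ℂ)) x :=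
    (h2.fderiv_right (m := 1) (natCast_lt_infty 2).le).differentiableAt (by simp)
  have key : ∀ a b : E, (dirDeriv a (dirDeriv b f) : E → ℂ) x =
      fderiv ℝ (fderiv ℝ (f : E → ℂ)) x a b := by
    intro a b
    rw [dirDeriv_apply]
    change fderiv ℝ (fun y => fderiv ℝ (f : E → ℂ) y b) x a = _
    rw [fderiv_clm_apply hd (differentiableAt_const b)]
    simp
  change (dirDeriv v (dirDeriv w f) : E → ℂ) x = (dirDeriv w (dirDeriv v f) : E → ℂ) x
  rw [key, key, hs]

/-- This turns questions about higher derivatives into algebra in the ring of endomorphisms of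
smooth functions, where the directional derivatives commute. -/
lemma iteratedFDeriv_eq_prod_dirDeriv (f : SmoothFun E) :
    ∀ (l : ℕ) (x : E) (v : Fin l → E), iteratedFDeriv ℝ l (f : E → ℂ) x v =
      ((List.ofFn fun i => dirDeriv (v i)).prod f : E → ℂ) x
  | 0, x, v => by simp
  | l + 1, x, v => by
    have hd : DifferentiableAt ℝ (iteratedFDeriv ℝ l (f : E → ℂ)) x :=
      (contDiff_smoothFun f).contDiffAt.differentiableAt_iteratedFDeriv (natCast_lt_infty _)
    rw [hd.iteratedFDeriv_succ_apply_left', List.ofFn_succ, List.prod_cons, Module.End.mul_apply,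
      dirDeriv_apply]
    congr 2
    funext y
    exact iteratedFDeriv_eq_prod_dirDeriv f l y _

lemma iteratedFDeriv_comp_perm_of_contDiff {f : E → ℂ} (hf : ContDiff ℝ ∞ f) {l : ℕ} (x : E)
    (v : Fin l → E) (σ : Equiv.Perm (Fin l)) :
    iteratedFDeriv ℝ l f x (v ∘ σ) = iteratedFDeriv ℝ l f x v := by
  have h := iteratedFDeriv_eq_prod_dirDeriv ⟨f, hf⟩ l x
  simp only at h
  rw [h, h]
  refine congrArg (fun T : Module.End ℝ (SmoothFun E) => (T ⟨f, hf⟩ : E → ℂ) x) ?_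
  refine (σ.ofFn_comp_perm fun i => dirDeriv (v i)).prod_eq' ?_
  refine List.pairwise_of_forall_mem_list fun a ha b hb => ?_
  obtain ⟨i, rfl⟩ := (List.mem_ofFn' _ _).1 ha
  obtain ⟨k, rfl⟩ := (List.mem_ofFn' _ _).1 hb
  exact dirDeriv_commute _ _

/-- Polarization: differentiating the diagonal map `l` times gives the sum of the multilinear form
over all permutations of its arguments, which by symmetry is `l!` times the form itself. -/
lemma iteratedFDeriv_eq_zero_of_diagonal {f : E → ℂ} (hf : ContDiff ℝ ∞ f) {l : ℕ} {x : E}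
    (h : ∀ y : E, iteratedFDeriv ℝ l f x (fun _ => y) = 0) : iteratedFDeriv ℝ l f x = 0 := by
  ext v
  have h1 := (iteratedFDeriv ℝ l f x).iteratedFDeriv_comp_diagonal 0 v
  have h2 : (fun y : E => iteratedFDeriv ℝ l f x (fun _ => y)) = fun _ => 0 := funext h
  have h3 : ∀ σ : Equiv.Perm (Fin l), iteratedFDeriv ℝ l f x (fun i => v (σ i)) =
      iteratedFDeriv ℝ l f x v := fun σ => iteratedFDeriv_comp_perm_of_contDiff hf x v σ
  rw [h2, Finset.sum_congr rfl fun σ _ => h3 σ] at h1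
  have h4 : iteratedFDeriv ℝ l (fun _ : E => (0 : ℂ)) 0 = 0 := by
    have := iteratedFDeriv_fun_zero (𝕜 := ℝ) (E := E) (F := ℂ) (n := l)
    exact congrFun this 0
  rw [h4] at h1
  simpa [Nat.factorial_ne_zero] using h1.symm

/-- Taylor's formula with a bound on the remainder. -/
lemma norm_sub_taylor_le {f : E → ℂ} (hf : ContDiff ℝ ∞ f) (q : ℕ) {x y : E} {M : ℝ}
    (hM : ∀ t ∈ Icc (0 : ℝ) 1, ‖iteratedFDeriv ℝ q f (x + t • y)‖ ≤ M) :
    ‖f (x + y) - ∑ k ∈ Finset.range q, (k.factorial : ℝ)⁻¹ •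
      iteratedFDeriv ℝ k f x (fun _ => y)‖ ≤ M * ‖y‖ ^ q := by
  rcases q with _ | n
  · simpa using hM 1 (by simp)
  have hM0 : 0 ≤ M := (norm_nonneg _).trans (hM 0 (by simp))
  rw [map_add_eq_sum_add_integral_iteratedFDeriv (n := n)
    (fun t _ => hf.contDiffAt.of_le (by exact_mod_cast le_top)), add_sub_cancel_left, norm_smul]
  have h1 : ‖∫ t in (0 : ℝ)..1, (1 - t) ^ n • iteratedFDeriv ℝ (n + 1) f (x + t • y) (fun _ => y)‖
      ≤ M * ‖y‖ ^ (n + 1) * |(1 : ℝ) - 0| := by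
    refine intervalIntegral.norm_integral_le_of_norm_le_const fun t ht => ?_
    rw [uIoc_of_le zero_le_one] at ht
    rw [norm_smul]
    have h2 : ‖iteratedFDeriv ℝ (n + 1) f (x + t • y) (fun _ => y)‖ ≤ M * ‖y‖ ^ (n + 1) := by
      refine ((iteratedFDeriv ℝ (n + 1) f (x + t • y)).le_opNorm _).trans ?_
      rw [Finset.prod_const, Finset.card_univ, Fintype.card_fin]
      gcongr
      exact hM t ⟨ht.1.le, ht.2⟩
    have h3 : ‖(1 - t) ^ n‖ ≤ 1 := by
      rw [norm_pow]
      refine pow_le_one₀ (norm_nonneg _) ?_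
      rw [Real.norm_eq_abs, abs_le]
      constructor <;> linarith [ht.1, ht.2]
    calc _ ≤ 1 * (M * ‖y‖ ^ (n + 1)) := by gcongr
      _ = _ := one_mul _
  have h4 : ‖((n.factorial : ℝ))⁻¹‖ ≤ 1 := by
    rw [norm_inv, Real.norm_natCast]
    exact inv_le_one_of_one_le₀ (by exact_mod_cast Nat.one_le_iff_ne_zero.2 n.factorial_ne_zero)
  calc _ ≤ 1 * (M * ‖y‖ ^ (n + 1) * |(1 : ℝ) - 0|) := by gcongr
    _ = _ := by simp

/-- A smooth function of size `O(‖x - ξ‖ ^ q)` vanishes to order `q` at `ξ`. -/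
lemma iteratedFDeriv_eq_zero_of_isBigO [ProperSpace E] {f : E → ℂ} (hf : ContDiff ℝ ∞ f) {q : ℕ}
    {ξ : E} (h : f =O[𝓝 ξ] fun x => ‖x - ξ‖ ^ q) : ∀ l < q, iteratedFDeriv ℝ l f ξ = 0 := by
  intro l
  induction l using Nat.strong_induction_on with
  | _ l ih =>
  intro hl
  -- By induction the Taylor terms of degree below `l` vanish. As `f` and the Taylor remainder are
  -- both `O(‖y‖^(l+1))`, so is the homogeneous term of degree `l`, which is possible only if it is
  -- zero.
  refine iteratedFDeriv_eq_zero_of_diagonal hf ?_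
  refine Asymptotics.IsBigO.continuousMultilinearMap_apply_eq_zero ?_
  obtain ⟨M, hM⟩ := (isCompact_closedBall ξ 1).exists_bound_of_continuousOn
    (hf.continuous_iteratedFDeriv (m := l + 1) (by exact_mod_cast le_top)).continuousOn
  have h1 : (fun y => f (ξ + y)) =O[𝓝 0] fun y => ‖y‖ ^ (l + 1) := by
    have hten : Tendsto (fun y => ξ + y) (𝓝 0) (𝓝 ξ) := by
      have : Continuous fun y => ξ + y := by fun_prop
      simpa using this.tendsto 0
    have h2 := h.comp_tendsto hten
    refine h2.trans ?_
    refine Asymptotics.IsBigO.of_bound 1 ?_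
    filter_upwards [closedBall_mem_nhds (0 : E) one_pos] with y hy
    rw [mem_closedBall_zero_iff] at hy
    simp only [Function.comp, add_sub_cancel_left, norm_pow, norm_norm, one_mul]
    exact pow_le_pow_of_le_one (norm_nonneg _) hy hl
  have h3 : (fun y => f (ξ + y) - (l.factorial : ℝ)⁻¹ • iteratedFDeriv ℝ l f ξ (fun _ => y))
      =O[𝓝 0] fun y => ‖y‖ ^ (l + 1) := by
    refine Asymptotics.IsBigO.of_bound M ?_
    filter_upwards [closedBall_mem_nhds (0 : E) one_pos] with y hy
    rw [mem_closedBall_zero_iff] at hy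
    have h4 := norm_sub_taylor_le hf (l + 1) (x := ξ) (y := y) (M := M) fun t ht => by
      refine hM _ ?_
      rw [mem_closedBall_iff_norm, add_sub_cancel_left, norm_smul, Real.norm_of_nonneg ht.1]
      exact mul_le_one₀ ht.2 (norm_nonneg _) hy
    rw [Finset.sum_range_succ, Finset.sum_eq_zero, zero_add] at h4
    · simpa using h4
    · intro k hk
      have hk' := Finset.mem_range.1 hk
      rw [ih k hk' (hk'.trans hl)]
      simp
  have h5 := (h1.sub h3).const_smul_left (l.factorial : ℝ)
  refine h5.congr_left fun y => ?_
  simp [Nat.factorial_ne_zero]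

/-- A function which vanishes to order `q` at `ξ` has its `i`-th derivative of size
`O(‖x - ξ‖ ^ (q - i))`. -/
lemma norm_iteratedFDeriv_le_of_vanishing {f : E → ℂ} {U : Set E} (hU : IsOpen U)
    (hf : ContDiffOn ℝ ∞ f U) {q : ℕ} {ξ x : E} (hseg : segment ℝ ξ x ⊆ U)
    (h0 : ∀ l < q, iteratedFDeriv ℝ l f ξ = 0) {M : ℝ}
    (hM : ∀ y ∈ segment ℝ ξ x, ‖iteratedFDeriv ℝ q f y‖ ≤ M) :
    ∀ k ≤ q, ‖iteratedFDeriv ℝ (q - k) f x‖ ≤ M * ‖x - ξ‖ ^ k := by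
  have hM0 : 0 ≤ M := (norm_nonneg _).trans (hM x (right_mem_segment ℝ ξ x))
  suffices H : ∀ k ≤ q, ∀ y ∈ segment ℝ ξ x,
      ‖iteratedFDeriv ℝ (q - k) f y‖ ≤ M * ‖x - ξ‖ ^ k from
    fun k hk => H k hk x (right_mem_segment ℝ ξ x)
  intro k
  induction k with
  | zero => intro _ y hy; simpa using hM y hy
  | succ k ih =>
    intro hk y hy
    have hd : ∀ z ∈ segment ℝ ξ x, DifferentiableAt ℝ (iteratedFDeriv ℝ (q - (k + 1)) f) z :=
      fun z hz => (hf.contDiffAt (hU.mem_nhds (hseg hz))).differentiableAt_iteratedFDeriv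
        (natCast_lt_infty _)
    -- Descent in the order: the bound at order `q - k` is a Lipschitz constant at order `q - (k +
    -- 1)`, where the derivative vanishes at `ξ`. Each step gains a factor `‖x - ξ‖`.
    have hb : ∀ z ∈ segment ℝ ξ x, ‖fderiv ℝ (iteratedFDeriv ℝ (q - (k + 1)) f) z‖ ≤
        M * ‖x - ξ‖ ^ k := by
      intro z hz
      rw [norm_fderiv_iteratedFDeriv, show q - (k + 1) + 1 = q - k by lia]
      exact ih (by lia) z hz
    have := (convex_segment ξ x).norm_image_sub_le_of_norm_fderiv_le hd hb
      (left_mem_segment ℝ ξ x) hy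
    rw [h0 _ (by lia), sub_zero] at this
    have h1 : ‖y - ξ‖ ≤ ‖x - ξ‖ := by
      obtain ⟨t, ht, rfl⟩ := (segment_eq_image' ℝ ξ x ▸ hy)
      simp only [add_sub_cancel_left, norm_smul, Real.norm_of_nonneg ht.1]
      exact mul_le_of_le_one_left (norm_nonneg _) ht.2
    calc _ ≤ _ := this
      _ ≤ M * ‖x - ξ‖ ^ k * ‖x - ξ‖ := by gcongr
      _ = _ := by ring

end SmoothFunctions

/-! ### Smooth cutoffs -/

section Cutoff

variable {E : Type*} [NormedAddCommGroup E] [NormedSpace ℝ E] [FiniteDimensional ℝ E]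
  {G : Type*} [NormedAddCommGroup G] [NormedSpace ℝ G]

/-- A function which is smooth near a compact set agrees near this set with a smooth function
on the whole space. -/
lemma exists_contDiff_eqOn_of_isCompact {K U : Set E} (hK : IsCompact K) (hU : IsOpen U)
    (hKU : K ⊆ U) {f : E → G} (hf : ContDiffOn ℝ ∞ f U) :
    ∃ (W : Set E) (χ : E → ℝ), IsOpen W ∧ K ⊆ W ∧ W ⊆ U ∧ (∀ x, x ∉ U → χ x = 0) ∧
      (∀ x ∈ W, χ x = 1) ∧ ContDiff ℝ ∞ fun x => χ x • f x := by
  obtain ⟨L, hL, hKL, hLU⟩ := exists_compact_between hK hU hKU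
  obtain ⟨χ, h1, h0, -⟩ := exists_contMDiffMap_one_nhds_of_subset_interior
    (n := ⊤) (modelWithCornersSelf ℝ E) hK.isClosed hKL
  have hχ : ContDiff ℝ ∞ χ := χ.contMDiff.contDiff
  obtain ⟨V, hV, hKV, hV1⟩ := eventually_nhdsSet_iff_exists.1 h1
  refine ⟨V ∩ interior L, χ, hV.inter isOpen_interior, subset_inter hKV hKL,
    inter_subset_right.trans (interior_subset.trans hLU), fun x hx => h0 x fun h => hx (hLU h),
    fun x hx => hV1 x hx.1, ?_⟩
  rw [contDiff_iff_contDiffAt]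
  intro x
  by_cases hx : x ∈ U
  · exact hχ.contDiffAt.smul (hf.contDiffAt (hU.mem_nhds hx))
  · have : (fun x => χ x • f x) =ᶠ[𝓝 x] fun _ => 0 := by
      filter_upwards [hL.isClosed.isOpen_compl.mem_nhds fun h => hx (hLU h)] with y hy
      rw [h0 y hy, zero_smul]
    exact contDiffAt_const.congr_of_eventuallyEq this

end Cutoff

/-! ### Taylor terms in multinomial form -/

section Multinomial

variable {d : ℕ}

lemma coe_pow_dirDeriv (k : Fin d) (r : ℕ) (f : SmoothFun (Euc d)) :
    ((dirDeriv (EuclideanSpace.single k (1 : ℝ)) ^ r) f : Euc d → ℂ) = (partialDeriv k)^[r] f := by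
  induction r with
  | zero => rfl
  | succ r ih =>
    rw [pow_succ', Module.End.mul_apply, Function.iterate_succ_apply', ← ih]
    rfl

/-- The bridge between `mixedPartial`, a fold over functions, and products of commuting operators.
-/
lemma coe_prod_dirDeriv (α : Fin d → ℕ) (f : SmoothFun (Euc d)) (l : List (Fin d)) :
    ((l.map fun k => dirDeriv (EuclideanSpace.single k (1 : ℝ)) ^ α k).prod f : Euc d → ℂ) =
      l.foldr (fun k h => (partialDeriv k)^[α k] h) f := by
  induction l with
  | nil => rfl
  | cons k l ih =>
    rw [List.map_cons, List.prod_cons, Module.End.mul_apply, coe_pow_dirDeriv, ih, List.foldr_cons]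

lemma prod_map_smul_pow {R : Type*} [Ring R] [Algebra ℝ R] (D : Fin d → R) (α : Fin d → ℕ)
    (y : Fin d → ℝ) (l : List (Fin d)) :
    (l.map fun k => (y k • D k) ^ α k).prod =
      (l.map fun k => y k ^ α k).prod • (l.map fun k => D k ^ α k).prod := by
  induction l with
  | nil => simp
  | cons k l ih =>
    rw [List.map_cons, List.prod_cons, ih, List.map_cons, List.prod_cons, List.map_cons,
      List.prod_cons, smul_pow, smul_mul_smul_comm]

lemma dirDeriv_eq_sum (y : Euc d) :
    dirDeriv y = ∑ k, y k • dirDeriv (EuclideanSpace.single k (1 : ℝ)) := by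
  ext f x
  have hy : y = ∑ k, y k • EuclideanSpace.single k (1 : ℝ) := by
    ext i
    simp [Pi.single_apply]
  rw [dirDeriv_apply]
  nth_rw 1 [hy]
  simp only [map_sum, map_smul, LinearMap.sum_apply, LinearMap.smul_apply,
    Submodule.coe_sum, Submodule.coe_smul, Finset.sum_apply, Pi.smul_apply, dirDeriv_apply]

/-- The multinomial form of the terms of Taylor's formula. -/
lemma iteratedFDeriv_diagonal_eq_sum_mixedPartial (f : SmoothFun (Euc d)) (l : ℕ)
    (x y : Euc d) :
    (l.factorial : ℝ)⁻¹ • iteratedFDeriv ℝ l (f : Euc d → ℂ) x (fun _ => y) =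
      ∑ α ∈ Finset.piAntidiag Finset.univ l, ((∏ k, (α k).factorial : ℕ) : ℂ)⁻¹ *
        (mixedPartial α (f : Euc d → ℂ) x * ∏ k, ((y k : ℝ) : ℂ) ^ α k) := by
  -- On the diagonal the derivative is the `l`-th power of `∑ yₖ ∂ₖ`, to which the multinomial
  -- theorem for commuting elements applies.
  rw [iteratedFDeriv_eq_prod_dirDeriv, List.ofFn_const, List.prod_replicate, dirDeriv_eq_sum,
    Finset.sum_pow_eq_sum_piAntidiag_of_commute _ _ (fun i _ k _ _ =>
      ((dirDeriv_commute _ _).smul_left _).smul_right _)]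
  simp only [LinearMap.sum_apply, Submodule.coe_sum, Finset.sum_apply, Finset.smul_sum]
  refine Finset.sum_congr rfl fun α hα => ?_
  -- The order of the factors is fixed to that of `List.finRange d`, the one used by `mixedPartial`.
  have h2 : Finset.univ.noncommProd
      (fun k => (y k • dirDeriv (EuclideanSpace.single k (1 : ℝ))) ^ α k)
      (fun i _ k _ _ => (((dirDeriv_commute _ _).smul_left _).smul_right _).pow_pow _ _) =
      ((List.finRange d).map fun k => (y k • dirDeriv (EuclideanSpace.single k (1 : ℝ))) ^ α k).prod
      := by
    rw [← Finset.noncommProd_toFinset _ _ (fun i _ k _ _ =>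
      (((dirDeriv_commute _ _).smul_left _).smul_right _).pow_pow _ _) (List.nodup_finRange d)]
    simp only [List.toFinset_finRange]
  rw [h2, prod_map_smul_pow (R := Module.End ℝ (SmoothFun (Euc d)))
    (fun k => dirDeriv (EuclideanSpace.single k (1 : ℝ))) α (fun k => y k), ← nsmul_eq_mul,
    ← Nat.cast_smul_eq_nsmul ℝ, LinearMap.smul_apply, LinearMap.smul_apply,
    Submodule.coe_smul, Submodule.coe_smul, coe_prod_dirDeriv, Pi.smul_apply, Pi.smul_apply]
  have h3 : ((List.finRange d).map fun k => y k ^ α k).prod = ∏ k, y k ^ α k := by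
    rw [← List.prod_ofFn, List.ofFn_eq_map]
  have h4 : (∏ k, (α k).factorial) * Nat.multinomial Finset.univ α = l.factorial := by
    rw [Nat.multinomial_spec, (Finset.mem_piAntidiag.1 hα).1]
  have h5 : ((∏ k, (α k).factorial : ℕ) : ℂ) ≠ 0 := by
    exact_mod_cast Finset.prod_ne_zero_iff.2 fun k _ => (α k).factorial_ne_zero
  have h6 : ((l.factorial : ℕ) : ℂ) ≠ 0 := by exact_mod_cast l.factorial_ne_zero
  have h7 : (Nat.multinomial Finset.univ α : ℂ) =
      l.factorial / ((∏ k, (α k).factorial : ℕ) : ℂ) := by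
    rw [eq_div_iff h5, ← h4]
    push_cast
    ring
  rw [h3]
  change ((l.factorial : ℝ)⁻¹) • ((Nat.multinomial Finset.univ α : ℝ) • ((∏ k, y k ^ α k) •
    mixedPartial α (f : Euc d → ℂ) x)) = _
  rw [Complex.real_smul, Complex.real_smul, Complex.real_smul, Complex.ofReal_natCast, h7]
  push_cast at h5 ⊢
  field_simp

end Multinomial

/-! ### Geometry of the tube and its coordinates -/

namespace FramedSubmanifold

variable {n d : ℕ} {X : FramedSubmanifold n d} {Ω : TopologicalSpace.Opens (Euc n)}

lemma mem_tube_of_mem {ξ : Euc n} (hξ : ξ ∈ X.carrier) : ξ ∈ tube X.carrier X.eps :=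
  ⟨ξ, hξ, by simpa using X.isTubular.eps_pos ξ hξ⟩

lemma norm_sub_proj_le {x : Euc n} (hx : x ∈ tube X.carrier X.eps) {ζ : Euc n}
    (hζ : ζ ∈ X.carrier) : ‖x - X.proj x‖ ≤ ‖x - ζ‖ := by
  by_cases h : ζ = X.proj x
  · rw [h]
  · exact (X.isTubular.closest x hx ζ hζ h).le

lemma proj_eq_of_forall_le {x ξ : Euc n} (hx : x ∈ tube X.carrier X.eps) (hξ : ξ ∈ X.carrier)
    (h : ∀ ζ ∈ X.carrier, ‖x - ξ‖ ≤ ‖x - ζ‖) : X.proj x = ξ := by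
  by_contra hne
  exact absurd (X.isTubular.closest x hx ξ hξ (Ne.symm hne))
    (not_lt.2 (h _ (X.isTubular.proj_mem x hx)))

lemma proj_of_mem {ξ : Euc n} (hξ : ξ ∈ X.carrier) : X.proj ξ = ξ :=
  proj_eq_of_forall_le (mem_tube_of_mem hξ) hξ fun ζ _ => by simp

lemma contDiffAt_proj {x : Euc n} (hx : x ∈ tube X.carrier X.eps) : ContDiffAt ℝ ∞ X.proj x :=
  X.isTubular.smooth.contDiffAt (isOpen_tube.mem_nhds hx)

lemma contDiffAt_comp_proj {G : Type*} [NormedAddCommGroup G] [NormedSpace ℝ G] {f : Euc n → G}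
    (hf : SmoothOnSubset X.carrier f) {x : Euc n} (hx : x ∈ tube X.carrier X.eps) :
    ContDiffAt ℝ ∞ (fun y => f (X.proj y)) x := by
  obtain ⟨f', hf', he⟩ := hf _ (X.isTubular.proj_mem x hx)
  have hπ := contDiffAt_proj hx
  have hten : Tendsto X.proj (𝓝 x) (𝓝[X.carrier] (X.proj x)) :=
    tendsto_nhdsWithin_iff.2 ⟨hπ.continuousAt, by
      filter_upwards [isOpen_tube.mem_nhds hx] with y hy using X.isTubular.proj_mem y hy⟩
  exact (hf'.contDiffAt.comp x hπ).congr_of_eventuallyEq (he.comp_tendsto hten)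

lemma contDiffAt_frame_proj (k : Fin d) {x : Euc n} (hx : x ∈ tube X.carrier X.eps) :
    ContDiffAt ℝ ∞ (fun y => X.frame k (X.proj y)) x :=
  contDiffAt_comp_proj (X.isNormalFrame.smooth k) hx

/-- Minimality of the distance makes `x - π(x)` orthogonal to the tangent space, hence a combination
of the orthonormal normal frame. -/
lemma sum_inner_smul_frame {x : Euc n} (hx : x ∈ tube X.carrier X.eps) :
    ∑ k, inner ℝ (X.frame k (X.proj x)) (x - X.proj x) • X.frame k (X.proj x) =
      x - X.proj x := by
  have hp := X.isTubular.proj_mem x hx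
  have ho := X.isNormalFrame.orthonormal _ hp
  obtain ⟨c, hc⟩ := (Submodule.mem_span_range_iff_exists_fun ℝ).1
    ((X.isNormalFrame.mem_span_iff _ hp _).2 (inner_eq_zero hx))
  have hin : ∀ k, inner ℝ (X.frame k (X.proj x)) (x - X.proj x) = c k := fun k => by
    rw [← hc]
    exact ho.inner_right_fintype c k
  simp only [hin, hc]

variable (X) in
/-- The point `ξ + ∑ₖ yₖ 𝐧ₖ(ξ)` of the normal space at `ξ`. -/
noncomputable def normalPoint (ξ : Euc n) (y : Euc d) : Euc n := ξ + ∑ k, y k • X.frame k ξ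

lemma norm_sum_smul_frame {ξ : Euc n} (hξ : ξ ∈ X.carrier) (y : Euc d) :
    ‖∑ k, y k • X.frame k ξ‖ = ‖y‖ := by
  have ho := X.isNormalFrame.orthonormal _ hξ
  rw [← sq_eq_sq₀ (norm_nonneg _) (norm_nonneg _), ← real_inner_self_eq_norm_sq,
    ho.inner_sum, EuclideanSpace.norm_sq_eq]
  simp [sq]

/-- The range of the derivative of the projection at `ξ` is the tangent space, because the
projection is a submersion fixing `ξ`. -/
lemma inner_sum_smul_frame_fderiv {ξ : Euc n} (hξ : ξ ∈ X.carrier) (y : Euc d) (u : Euc n) :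
    inner ℝ (∑ k, y k • X.frame k ξ) (fderiv ℝ X.proj ξ u) = 0 := by
  have h := X.isTubular.submersion ξ (mem_tube_of_mem hξ)
  rw [proj_of_mem hξ] at h
  refine (X.isNormalFrame.mem_span_iff ξ hξ _).1 ?_ _ (h ▸ mem_range_self u)
  exact (Submodule.mem_span_range_iff_exists_fun ℝ).2 ⟨_, rfl⟩

/-- Uniformly near a point of the submanifold, two of its points differ by a tangent vector up to a
quadratic error. -/
lemma exists_norm_sub_fderiv_proj_le {ξ₀ : Euc n} (hξ₀ : ξ₀ ∈ X.carrier) :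
    ∃ r > (0 : ℝ), ∃ C ≥ (0 : ℝ), ball ξ₀ r ⊆ tube X.carrier X.eps ∧
      ∀ ξ ∈ X.carrier ∩ ball ξ₀ r, ∀ ζ ∈ X.carrier ∩ ball ξ₀ r,
        ‖ζ - ξ - fderiv ℝ X.proj ξ (ζ - ξ)‖ ≤ C * ‖ζ - ξ‖ ^ 2 := by
  have hπ := contDiffAt_proj (mem_tube_of_mem hξ₀)
  -- The projection is the identity on the submanifold, so the claim is its first-order Taylor
  -- estimate, uniform because its derivative is Lipschitz near `ξ₀`.
  obtain ⟨C, V, hV, hL⟩ := (hπ.fderiv_right (m := 1) (natCast_lt_infty 2).le).exists_lipschitzOnWith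
  obtain ⟨r, hr, hball⟩ := Metric.mem_nhds_iff.1
    (inter_mem hV (isOpen_tube.mem_nhds (mem_tube_of_mem hξ₀)))
  refine ⟨r, hr, C, C.2, fun x hx => (hball hx).2, fun ξ hξ ζ hζ => ?_⟩
  have hseg : segment ℝ ξ ζ ⊆ ball ξ₀ r := (convex_ball ξ₀ r).segment_subset hξ.2 hζ.2
  have h := (convex_segment ξ ζ).norm_image_sub_le_of_norm_fderiv_le' (f := X.proj)
    (φ := fderiv ℝ X.proj ξ) (C := C * ‖ζ - ξ‖) (𝕜 := ℝ)
    (fun z hz => (contDiffAt_proj (hball (hseg hz)).2).differentiableAt (by simp))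
    (fun z hz => by
      have h1 := hL.norm_sub_le (hball (hseg hz)).1 (hball hξ.2).1
      refine h1.trans ?_
      gcongr
      obtain ⟨t, ht, rfl⟩ := (segment_eq_image' ℝ ξ ζ ▸ hz)
      simp only [add_sub_cancel_left, norm_smul, Real.norm_of_nonneg ht.1]
      exact mul_le_of_le_one_left (norm_nonneg _) ht.2)
    (left_mem_segment ℝ ξ ζ) (right_mem_segment ℝ ξ ζ)
  rw [proj_of_mem hξ.1, proj_of_mem hζ.1] at h
  exact h.trans (le_of_eq (by ring))

/-- Points on short normal segments have the expected tube coordinates. -/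
lemma exists_normalPoint_mem_region {ξ₀ : Euc n} (hξ₀ : ξ₀ ∈ X.base Ω) :
    ∃ r > (0 : ℝ), ∃ t₀ > (0 : ℝ), ∀ ξ ∈ X.carrier ∩ ball ξ₀ r, ∀ w ∈ sphere (0 : Euc d) 1, ∀ t ∈ Ioc 0 t₀,
      X.normalPoint ξ (t • w) ∈ X.region Ω \ X.carrier ∧ X.proj (X.normalPoint ξ (t • w)) = ξ := by
  obtain ⟨r, hr, C, hC, hball, hquad⟩ := exists_norm_sub_fderiv_proj_le hξ₀.1
  have he₀ := X.isTubular.eps_pos ξ₀ hξ₀.1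
  obtain ⟨r', hr', hΩ⟩ := Metric.mem_nhds_iff.1 (Ω.isOpen.mem_nhds hξ₀.2)
  obtain ⟨r'', hr'', heps⟩ := Metric.mem_nhdsWithin_iff.1
    ((X.isTubular.eps_cont ξ₀ hξ₀.1).eventually (lt_mem_nhds (half_lt_self he₀)))
  set s := min r (min r' r'') with hs
  have hs0 : 0 < s := lt_min hr (lt_min hr' hr'')
  have hsr : s ≤ r := min_le_left _ _
  have hsr' : s ≤ r' := (min_le_right _ _).trans (min_le_left _ _)
  have hsr'' : s ≤ r'' := (min_le_right _ _).trans (min_le_right _ _)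
  -- The first bound keeps the normal point in the small ball and closer to `ξ` than to any point of
  -- the submanifold outside the `r`-ball. The second gives `t < ε(ξ₀)/4 < ε(ξ)/2`. The third gives
  -- `2tC ≤ 1`, which beats the quadratic deviation of the submanifold from its tangent space.
  set t₀ := min (s / 5) (min (X.eps ξ₀ / 5) (1 / (2 * (C + 1)))) with ht₀
  have ht0 : 0 < t₀ := lt_min (by positivity) (lt_min (by positivity) (by positivity))
  refine ⟨s / 2, by positivity, t₀, ht0, fun ξ hξ w hw t ht => ?_⟩
  have hts : t ≤ s / 5 := ht.2.trans (min_le_left _ _)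
  have hte : t ≤ X.eps ξ₀ / 5 := ht.2.trans ((min_le_right _ _).trans (min_le_left _ _))
  have htC : t * (2 * (C + 1)) ≤ 1 := by
    have : t ≤ 1 / (2 * (C + 1)) := ht.2.trans ((min_le_right _ _).trans (min_le_right _ _))
    rwa [le_div_iff₀ (by positivity)] at this
  set ν : Euc n := ∑ k, w k • X.frame k ξ with hν
  have hν1 : ‖ν‖ = 1 := by
    rw [hν, norm_sum_smul_frame hξ.1]
    exact mem_sphere_zero_iff_norm.1 hw
  have hx : X.normalPoint ξ (t • w) = ξ + t • ν := by
    simp [normalPoint, hν, Finset.smul_sum, smul_smul]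
  rw [hx]
  have hξs : dist ξ ξ₀ < s / 2 := hξ.2
  have htn : ‖t • ν‖ = t := by rw [norm_smul, hν1, mul_one, Real.norm_of_nonneg ht.1.le]
  have hxs : dist (ξ + t • ν) ξ₀ < s := by
    calc _ ≤ dist (ξ + t • ν) ξ + dist ξ ξ₀ := dist_triangle _ _ _
      _ < s := by
        rw [dist_eq_norm, add_sub_cancel_left, htn]
        linarith
  have hxt : ξ + t • ν ∈ tube X.carrier X.eps := hball (hxs.trans_le hsr)
  have hproj : X.proj (ξ + t • ν) = ξ := by
    refine proj_eq_of_forall_le hxt hξ.1 fun ζ hζ => ?_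
    rw [add_sub_cancel_left, htn]
    by_cases hζr : ζ ∈ ball ξ₀ r
    · have h1 := hquad ξ ⟨hξ.1, hξs.trans (by linarith)⟩ ζ ⟨hζ, hζr⟩
      have h2 : |inner ℝ ν (ζ - ξ)| ≤ C * ‖ζ - ξ‖ ^ 2 := by
        have h3 : inner ℝ ν (ζ - ξ) = inner ℝ ν (ζ - ξ - fderiv ℝ X.proj ξ (ζ - ξ)) := by
          rw [inner_sub_right ν (ζ - ξ) (fderiv ℝ X.proj ξ (ζ - ξ)), hν,
            inner_sum_smul_frame_fderiv hξ.1, sub_zero]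
        rw [h3]
        refine (abs_real_inner_le_norm _ _).trans ?_
        rw [hν1, one_mul]
        exact h1
      have h4 : ‖ξ + t • ν - ζ‖ ^ 2 = ‖ζ - ξ‖ ^ 2 - 2 * (t * inner ℝ ν (ζ - ξ)) + t ^ 2 := by
        rw [show ξ + t • ν - ζ = t • ν - (ζ - ξ) by abel, norm_sub_sq_real, htn,
          real_inner_smul_left]
        ring
      -- For nearby `ζ`, the cross term is at most `2tC‖ζ - ξ‖² ≤ ‖ζ - ξ‖²`, since the normal `ν`
      -- sees only the quadratic error of `ζ - ξ`.
      have h5 : t ^ 2 ≤ ‖ξ + t • ν - ζ‖ ^ 2 := by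
        have h6 := (abs_le.1 h2).2
        have h7 : t * inner ℝ ν (ζ - ξ) ≤ t * (C * ‖ζ - ξ‖ ^ 2) :=
          mul_le_mul_of_nonneg_left h6 ht.1.le
        have h8 : 2 * t * C * ‖ζ - ξ‖ ^ 2 ≤ 1 * ‖ζ - ξ‖ ^ 2 :=
          mul_le_mul_of_nonneg_right (by nlinarith [ht.1]) (sq_nonneg _)
        rw [h4]
        linarith
      exact (pow_le_pow_iff_left₀ ht.1.le (norm_nonneg _) two_ne_zero).1 h5
    · rw [mem_ball, not_lt] at hζr
      have h1 : dist ζ ξ₀ ≤ dist ζ (ξ + t • ν) + dist (ξ + t • ν) ξ₀ := dist_triangle _ _ _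
      have h2 : dist (ξ + t • ν) ξ₀ ≤ dist (ξ + t • ν) ξ + dist ξ ξ₀ := dist_triangle _ _ _
      rw [dist_comm ζ (ξ + t • ν), dist_eq_norm (ξ + t • ν) ζ] at h1
      rw [dist_eq_norm (ξ + t • ν) ξ, add_sub_cancel_left, htn] at h2
      linarith
  have hne : ξ + t • ν ∉ X.carrier := fun h => by
    have h1 := hproj
    rw [proj_of_mem h, add_eq_left] at h1
    rw [h1, norm_zero] at htn
    exact ht.1.ne htn
  have hξeps : X.eps ξ₀ / 2 < X.eps ξ :=
    heps ⟨hξs.trans (by linarith), hξ.1⟩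
  refine ⟨⟨⟨hΩ (hxs.trans_le hsr'), hxt, ?_, ?_⟩, hne⟩, hproj⟩
  · rw [rho, hproj, add_sub_cancel_left, htn]
    linarith
  · rw [hproj]
    exact hΩ (hξs.trans (by linarith))

lemma exists_normalPoint_mem_region_of_isCompact {K : Set (Euc n)} (hK : IsCompact K)
    (hKb : K ⊆ X.base Ω) :
    ∃ U : Set (Euc n), IsOpen U ∧ K ⊆ U ∧ ∃ t₀ > (0 : ℝ), ∀ ξ ∈ X.carrier ∩ U,
      ∀ w ∈ sphere (0 : Euc d) 1, ∀ t ∈ Ioc 0 t₀,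
      X.normalPoint ξ (t • w) ∈ X.region Ω \ X.carrier ∧ X.proj (X.normalPoint ξ (t • w)) = ξ := by
  refine hK.induction_on (p := fun K => ∃ U : Set (Euc n), IsOpen U ∧ K ⊆ U ∧ ∃ t₀ > (0 : ℝ),
    ∀ ξ ∈ X.carrier ∩ U, ∀ w ∈ sphere (0 : Euc d) 1, ∀ t ∈ Ioc 0 t₀,
    X.normalPoint ξ (t • w) ∈ X.region Ω \ X.carrier ∧ X.proj (X.normalPoint ξ (t • w)) = ξ)
    ⟨∅, isOpen_empty, subset_rfl, 1, one_pos, by simp⟩ ?_ ?_ ?_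
  · rintro s t hst ⟨U, hU, hsU, h⟩
    exact ⟨U, hU, hst.trans hsU, h⟩
  · rintro s t ⟨U, hU, hsU, a, ha, h⟩ ⟨V, hV, htV, b, hb, h'⟩
    refine ⟨U ∪ V, hU.union hV, union_subset_union hsU htV, min a b, lt_min ha hb, ?_⟩
    rintro ξ ⟨hξ, hξU | hξV⟩ w hw c hc
    · exact h ξ ⟨hξ, hξU⟩ w hw c ⟨hc.1, hc.2.trans (min_le_left _ _)⟩
    · exact h' ξ ⟨hξ, hξV⟩ w hw c ⟨hc.1, hc.2.trans (min_le_right _ _)⟩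
  · intro ξ₀ hξ₀
    obtain ⟨r, hr, t₀, ht₀, h⟩ := exists_normalPoint_mem_region (hKb hξ₀)
    exact ⟨ball ξ₀ r, mem_nhdsWithin_of_mem_nhds (ball_mem_nhds _ hr), ball ξ₀ r, isOpen_ball,
      subset_rfl, t₀, ht₀, h⟩

lemma rho_normalPoint {ξ : Euc n} (hξ : ξ ∈ X.carrier) {w : Euc d} (hw : w ∈ sphere (0 : Euc d) 1)
    {t : ℝ} (ht : 0 < t) (h : X.proj (X.normalPoint ξ (t • w)) = ξ) :
    X.rho (X.normalPoint ξ (t • w)) = t := by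
  rw [rho, h, normalPoint, add_sub_cancel_left, norm_sum_smul_frame hξ, norm_smul,
    mem_sphere_zero_iff_norm.1 hw, mul_one, Real.norm_of_nonneg ht.le]

lemma omega_normalPoint {ξ : Euc n} (hξ : ξ ∈ X.carrier) {w : Euc d}
    (hw : w ∈ sphere (0 : Euc d) 1) {t : ℝ} (ht : 0 < t)
    (h : X.proj (X.normalPoint ξ (t • w)) = ξ) : X.omega (X.normalPoint ξ (t • w)) = w := by
  ext k
  simp only [omega, rho_normalPoint hξ hw ht h, h]
  rw [normalPoint, add_sub_cancel_left,
    (X.isNormalFrame.orthonormal _ hξ).inner_right_fintype (fun k => (t • w) k) k]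
  simp [ht.ne']

/-- Along a normal segment `ξ` and `ω` are constant and `ρ` is the parameter, so a term becomes a
monomial in `t`. -/
lemma term_normalPoint (a : X.bundle Ω → ℂ) (j : ℤ) {p : Euc n × Euc d} (hp : p ∈ X.bundle Ω)
    {t : ℝ} (ht : 0 < t) (h : X.proj (X.normalPoint p.1 (t • p.2)) = p.1) :
    X.term Ω a j (X.normalPoint p.1 (t • p.2)) = a ⟨p, hp⟩ * ((t ^ j : ℝ) : ℂ) := by
  rw [term, rho_normalPoint hp.1.1 hp.2 ht h, omega_normalPoint hp.1.1 hp.2 ht h, h,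
    zeroExt_of_mem _ hp]

lemma isOpen_region : IsOpen (X.region Ω) := by
  rw [isOpen_iff_mem_nhds]
  rintro x ⟨hxΩ, hxt, hxr, hxp⟩
  have hπ := (contDiffAt_proj hxt).continuousAt
  have hρ : ContinuousAt X.rho x := (continuousAt_id.sub hπ).norm
  have hten : Tendsto X.proj (𝓝 x) (𝓝[X.carrier] (X.proj x)) :=
    tendsto_nhdsWithin_iff.2 ⟨hπ, by
      filter_upwards [isOpen_tube.mem_nhds hxt] with y hy using X.isTubular.proj_mem y hy⟩
  have hε : Tendsto (fun y => X.eps (X.proj y) / 2) (𝓝 x) (𝓝 (X.eps (X.proj x) / 2)) :=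
    ((X.isTubular.eps_cont _ (X.isTubular.proj_mem x hxt)).tendsto.comp hten).div_const 2
  filter_upwards [Ω.isOpen.mem_nhds hxΩ, isOpen_tube.mem_nhds hxt, hρ.eventually_lt hε hxr,
    hπ.preimage_mem_nhds (Ω.isOpen.mem_nhds hxp)] with y h1 h2 h3 h4
  exact ⟨h1, h2, h3, h4⟩

lemma isOpen_region_diff : IsOpen (X.region Ω \ X.carrier) :=
  isOpen_region.sdiff X.isClosedSubmanifold.isClosed

/-- Near a compact part of the submanifold, the projection and the frame extend to smooth maps
of the ambient space. -/
lemma exists_smooth_extension {K : Set (Euc n)} (hK : IsCompact K) (hKS : K ⊆ X.carrier) :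
    ∃ (W : Set (Euc n)) (P : Euc n → Euc n) (M : Fin d → Euc n → Euc n), IsOpen W ∧ K ⊆ W ∧
      ContDiff ℝ ∞ P ∧ (∀ k, ContDiff ℝ ∞ (M k)) ∧
      ∀ x ∈ X.carrier ∩ W, P x = x ∧ ∀ k, M k x = X.frame k x := by
  obtain ⟨W, χ, hW, hKW, -, -, h1, hs⟩ := exists_contDiff_eqOn_of_isCompact hK isOpen_tube
    (fun x hx => mem_tube_of_mem (hKS hx))
    -- The frame is given only on the submanifold; composing it with the projection makes it smooth
    -- on the open tube, where a cutoff can be applied.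
    (f := fun x => (X.proj x, fun k => X.frame k (X.proj x)))
    (fun x hx => ((contDiffAt_proj hx).prodMk
      (contDiffAt_pi.2 fun k => contDiffAt_frame_proj k hx)).contDiffWithinAt)
  refine ⟨W, fun x => χ x • X.proj x, fun k x => χ x • X.frame k (X.proj x), hW, hKW,
    hs.fst, fun k => contDiff_pi.1 hs.snd k, fun x hx => ?_⟩
  simp [h1 x hx.2, proj_of_mem hx.1]

end FramedSubmanifold

/-! ### Bounds for derivatives of compositions -/

section Composition

variable {E F G : Type*} [NormedAddCommGroup E] [NormedSpace ℝ E] [NormedAddCommGroup F]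
  [NormedSpace ℝ F] [NormedAddCommGroup G] [NormedSpace ℝ G]

lemma exists_bound_iteratedFDeriv {g : E → F} (hg : ContDiff ℝ ∞ g) {K : Set E} (hK : IsCompact K)
    (k : ℕ) : ∃ D : ℝ, 1 ≤ D ∧ ∀ i ≤ k, ∀ x ∈ K, ‖iteratedFDeriv ℝ i g x‖ ≤ D := by
  choose D hD using fun i : ℕ => hK.exists_bound_of_continuousOn
    (hg.continuous_iteratedFDeriv (m := i) (natCast_lt_infty i).le).continuousOn
  refine ⟨1 + ∑ i ∈ Finset.range (k + 1), |D i|, ?_, fun i hi x hx => ?_⟩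
  · have : 0 ≤ ∑ i ∈ Finset.range (k + 1), |D i| := Finset.sum_nonneg fun i _ => abs_nonneg _
    linarith
  · have h1 : |D i| ≤ ∑ i ∈ Finset.range (k + 1), |D i| :=
      Finset.single_le_sum (f := fun i => |D i|) (fun i _ => abs_nonneg _)
        (Finset.mem_range.2 (by lia))
    linarith [hD i x hx, le_abs_self (D i)]

/-- The Faà di Bruno bound asks for `D ^ l` at each order `l ≥ 1`; as `1 ≤ D`, the single bound `D`
implies this and serves all orders up to `k` at once. -/
lemma norm_iteratedFDeriv_comp_le_of_isOpen {f : F → G} {V : Set F} (hV : IsOpen V)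
    (hf : ContDiffOn ℝ ∞ f V) {g : E → F} (hg : ContDiff ℝ ∞ g) {x : E} (hx : g x ∈ V) {k : ℕ}
    {C D : ℝ} (hD1 : 1 ≤ D) (hC : ∀ i ≤ k, ‖iteratedFDeriv ℝ i f (g x)‖ ≤ C)
    (hD : ∀ i ≤ k, ‖iteratedFDeriv ℝ i g x‖ ≤ D) :
    ∀ i ≤ k, ‖iteratedFDeriv ℝ i (f ∘ g) x‖ ≤ k.factorial * C * D ^ k := by
  intro i hi
  have hC0 : 0 ≤ C := (norm_nonneg _).trans (hC 0 (Nat.zero_le k))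
  have hU : IsOpen (g ⁻¹' V) := hV.preimage hg.continuous
  have h := norm_iteratedFDerivWithin_comp_le (n := i) (s := g ⁻¹' V) (t := V) (x := x) hf
    hg.contDiffOn (natCast_lt_infty i).le hV.uniqueDiffOn hU.uniqueDiffOn (fun _ h => h) hx
    (C := C) (D := D)
    (fun l hl => by
      rw [iteratedFDerivWithin_of_isOpen l hV hx]
      exact hC l (hl.trans hi))
    (fun l hl1 hl => by
      rw [iteratedFDerivWithin_of_isOpen l hU hx]
      exact (hD l (hl.trans hi)).trans (le_self_pow₀ hD1 (by lia)))
  rw [iteratedFDerivWithin_of_isOpen i hU hx] at h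
  refine h.trans ?_
  gcongr

end Composition

/-- The coefficients of an asymptotic expansion in powers of `t` are unique. -/
lemma coeff_eq_zero_of_isBigO {c : ℤ → ℂ} {m : ℤ} {t₀ : ℝ} (ht₀ : 0 < t₀)
    (h : ∀ q : ℤ, ∃ C : ℝ, ∀ t ∈ Ioc 0 t₀,
      ‖∑ j ∈ Finset.Ico m q, c j * ((t ^ j : ℝ) : ℂ)‖ ≤ C * t ^ q) : ∀ j ≥ m, c j = 0 := by
  have key : ∀ r : ℕ, c (m + r) = 0 := by
    intro r
    induction r using Nat.strong_induction_on with
    | _ r ih =>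
    -- With the earlier coefficients zero, this truncation consists of the single term `c (m + r)
    -- t^(m+r)`. Being `O(t^(m+r+1))`, it forces `‖c (m + r)‖ ≤ C t` for all small `t`.
    obtain ⟨C, hC⟩ := h (m + r + 1)
    have h1 : ∀ t ∈ Ioc 0 t₀, ‖c (m + r)‖ ≤ C * t := by
      intro t ht
      have h2 := hC t ht
      rw [Finset.sum_eq_single_of_mem (m + r : ℤ) (Finset.mem_Ico.2 ⟨by lia, by lia⟩)] at h2
      · have hp : 0 < t ^ (m + r : ℤ) := zpow_pos ht.1 _
        rw [norm_mul, Complex.norm_real, Real.norm_of_nonneg hp.le, zpow_add_one₀ ht.1.ne',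
          mul_comm (t ^ (m + r : ℤ)), ← mul_assoc] at h2
        exact le_of_mul_le_mul_right h2 hp
      · intro i hi hne
        obtain ⟨hi1, hi2⟩ := Finset.mem_Ico.1 hi
        have h3 := ih (i - m).toNat (by lia)
        rw [show m + ((i - m).toNat : ℤ) = i by lia] at h3
        rw [h3, zero_mul]
    have h4 : Tendsto (fun t : ℝ => C * t) (𝓝[>] 0) (𝓝 0) := by
      have : Continuous fun t : ℝ => C * t := by fun_prop
      simpa using (this.tendsto 0).mono_left nhdsWithin_le_nhds
    have h5 := ge_of_tendsto h4 (b := ‖c (m + r)‖) (by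
      filter_upwards [Ioc_mem_nhdsGT ht₀] with t ht using h1 t ht)
    exact norm_le_zero_iff.1 h5
  intro j hj
  have := key (j - m).toNat
  rwa [show m + ((j - m).toNat : ℤ) = j by lia] at this

/-! ### Coefficients of expansions and thick delta functions -/

namespace FramedSubmanifold

variable {n d : ℕ} {X : FramedSubmanifold n d} {Ω : TopologicalSpace.Opens (Euc n)}

lemma IsExpansion.norm_sub_sum_le {m : ℤ} {φ : Euc n → ℂ} {a : ℤ → X.bundle Ω → ℂ}
    (h : X.IsExpansion Ω m φ a) {p : Euc n × Euc d} (hp : p ∈ X.bundle Ω) {t₀ : ℝ}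
    (ht₀ : ∀ t ∈ Ioc 0 t₀, X.normalPoint p.1 (t • p.2) ∈ X.region Ω \ X.carrier ∧
      X.proj (X.normalPoint p.1 (t • p.2)) = p.1) (q : ℤ) :
    ∃ C : ℝ, ∀ t ∈ Ioc 0 t₀, ‖φ (X.normalPoint p.1 (t • p.2)) -
      ∑ j ∈ Finset.Ico m q, a j ⟨p, hp⟩ * ((t ^ j : ℝ) : ℂ)‖ ≤ C * t ^ q := by
  obtain ⟨C, hC⟩ := h.remainder_bound q 0
  refine ⟨C, fun t ht => ?_⟩
  obtain ⟨h1, h2⟩ := ht₀ t ht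
  have h3 := hC _ h1
  simp only [norm_iteratedFDeriv_zero, remainder, term_normalPoint _ _ hp ht.1 h2,
    rho_normalPoint hp.1.1 hp.2 ht.1 h2] at h3
  simpa using h3

/-- After lowering both starting degrees to the minimum, the difference of the two expansions on a
normal segment is an expansion of zero in powers of `t`. -/
lemma IsExpansion.coeff_unique {m m' : ℤ} {φ : Euc n → ℂ} {a b : ℤ → X.bundle Ω → ℂ}
    (h : X.IsExpansion Ω m φ a) (h' : X.IsExpansion Ω m' φ b) : a = b := by
  have h1 := h.mono (min_le_left m m')
  have h2 := h'.mono (min_le_right m m')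
  funext j ⟨p, hp⟩
  obtain ⟨r, hr, t₀, ht₀, hreg⟩ := exists_normalPoint_mem_region hp.1
  have hreg' := hreg p.1 ⟨hp.1.1, mem_ball_self hr⟩ p.2 hp.2
  rcases lt_or_ge j (min m m') with hj | hj
  · rw [h1.zero j hj, h2.zero j hj]
  · have key := coeff_eq_zero_of_isBigO (c := fun j => a j ⟨p, hp⟩ - b j ⟨p, hp⟩)
      (m := min m m') ht₀ (fun q => ?_) j hj
    · exact sub_eq_zero.1 key
    · obtain ⟨C, hC⟩ := h1.norm_sub_sum_le hp hreg' q
      obtain ⟨C', hC'⟩ := h2.norm_sub_sum_le hp hreg' q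
      refine ⟨C' + C, fun t ht => ?_⟩
      simp only [sub_mul, Finset.sum_sub_distrib]
      rw [add_mul, ← sub_sub_sub_cancel_left _ _ (φ (X.normalPoint p.1 (t • p.2)))]
      exact (norm_sub_le _ _).trans (add_le_add (hC' t ht) (hC t ht))

/-- Over a base point off the closed set `K`, a short enough normal segment avoids `K`, so the
one-variable expansion is one of zero. Compact support of the coefficients follows. -/
lemma IsExpansion.coeff_eq_zero {m : ℤ} {φ : Euc n → ℂ} {a : ℤ → X.bundle Ω → ℂ}
    (h : X.IsExpansion Ω m φ a) {K : Set (Euc n)} (hK : IsClosed K) (hφ : ∀ x ∉ K, φ x = 0)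
    (j : ℤ) (p : X.bundle Ω) (hp : p.1.1 ∉ K) : a j p = 0 := by
  obtain ⟨p, hpb⟩ := p
  obtain ⟨r, hr, t₀, ht₀, hreg⟩ := exists_normalPoint_mem_region hpb.1
  have hreg' := hreg p.1 ⟨hpb.1.1, mem_ball_self hr⟩ p.2 hpb.2
  rcases lt_or_ge j m with hj | hj
  · rw [h.zero j hj, Pi.zero_apply]
  have hcont : Continuous fun t : ℝ => X.normalPoint p.1 (t • p.2) := by
    unfold normalPoint
    simp only [PiLp.smul_apply]
    fun_prop
  have h0 : X.normalPoint p.1 ((0 : ℝ) • p.2) ∈ Kᶜ := by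
    simpa [normalPoint] using hp
  obtain ⟨s, hs, hsK⟩ := Metric.mem_nhds_iff.1
    (hcont.continuousAt.preimage_mem_nhds (hK.isOpen_compl.mem_nhds h0))
  have hmin : 0 < min t₀ (s / 2) := lt_min ht₀ (by positivity)
  refine coeff_eq_zero_of_isBigO (c := fun j => a j ⟨p, hpb⟩) hmin (fun q => ?_) j hj
  obtain ⟨C, hC⟩ := h.norm_sub_sum_le hpb hreg' q
  refine ⟨C, fun t ht => ?_⟩
  have h1 := hC t ⟨ht.1, ht.2.trans (min_le_left _ _)⟩
  have h2 : t ∈ ball (0 : ℝ) s := by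
    rw [mem_ball_zero_iff, Real.norm_of_nonneg ht.1.le]
    linarith [ht.2.trans (min_le_right _ _)]
  rw [hφ _ (hsK h2), zero_sub, norm_neg] at h1
  exact h1

lemma isCompact_inter_carrier {K : Set (Euc n)} (hK : IsCompact K) : IsCompact (K ∩ X.carrier) :=
  hK.inter_right X.isClosedSubmanifold.isClosed

lemma inter_carrier_subset_base {K : Set (Euc n)} (hKΩ : K ⊆ Ω) : K ∩ X.carrier ⊆ X.base Ω :=
  fun _ hx => ⟨hx.2, hKΩ hx.1⟩

lemma IsExpansion.coeff_mem {m : ℤ} {φ : Euc n → ℂ} {a : ℤ → X.bundle Ω → ℂ}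
    (h : X.IsExpansion Ω m φ a) {K : Set (Euc n)} (hK : IsCompact K) (hKΩ : K ⊆ Ω)
    (hφ : ∀ x ∉ K, φ x = 0) (j : ℤ) : a j ∈ SubTest (X.bundle Ω) := by
  refine ⟨h.smooth j, HasCompactSupport.intro (K := {p | p.1.1 ∈ K}) ?_ fun p hp =>
    h.coeff_eq_zero hK.isClosed hφ j p hp⟩
  rw [Subtype.isCompact_iff]
  have : ((↑) : X.bundle Ω → Euc n × Euc d) '' {p | p.1.1 ∈ K} =
      (K ∩ X.carrier) ×ˢ sphere (0 : Euc d) 1 := by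
    ext p
    constructor
    · rintro ⟨y, hy, rfl⟩
      exact ⟨⟨hy, y.2.1.1⟩, y.2.2⟩
    · rintro ⟨⟨hp, hpS⟩, hp2⟩
      exact ⟨⟨p, ⟨hpS, hKΩ hp⟩, hp2⟩, hp, rfl⟩
  rw [this]
  exact (isCompact_inter_carrier hK).prod (isCompact_sphere 0 1)

/-- The topology of thick test functions controls remainders only; this is how control passes to
individual terms. -/
lemma term_eq_remainder_sub {m j : ℤ} (hj : m ≤ j) (φ : Euc n → ℂ) (a : ℤ → X.bundle Ω → ℂ) :
    X.term Ω (a j) j = X.remainder Ω m φ a j - X.remainder Ω m φ a (j + 1) := by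
  funext x
  have h1 : Finset.Ico m (j + 1) = insert j (Finset.Ico m j) := by
    ext i
    simp only [Finset.mem_Ico, Finset.mem_insert]
    lia
  simp only [Pi.sub_apply, remainder]
  rw [h1, Finset.sum_insert (by simp)]
  ring

/-- Near a compact part of the bundle, the points of the normal sphere bundle of a small radius
depend smoothly on the coordinates of the ambient space. -/
lemma exists_smooth_normalPoint {K : Set (Euc n)} (hK : IsCompact K) (hKb : K ⊆ X.base Ω) :
    ∃ t₀ > (0 : ℝ), ∃ (O : Set (Euc n × Euc d)) (Q : Euc n × Euc d → Euc n), IsOpen O ∧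
      K ×ˢ sphere 0 1 ⊆ O ∧ ContDiff ℝ ∞ Q ∧ MapsTo Q O (X.region Ω \ X.carrier) ∧
      ∀ p ∈ O ∩ X.bundle Ω, Q p = X.normalPoint p.1 (t₀ • p.2) ∧ X.proj (Q p) = p.1 := by
  obtain ⟨U, hU, hKU, t₀, ht₀, hreg⟩ := exists_normalPoint_mem_region_of_isCompact hK hKb
  obtain ⟨W, P, M, hW, hKW, hP, hM, hPM⟩ := exists_smooth_extension hK fun _ hx => (hKb hx).1
  -- Replacing `ξ` and the frame by their ambient extensions makes the map smooth off the bundle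
  -- too, as the seminorms of `SubDistribution` need ambient derivatives.
  set Q : Euc n × Euc d → Euc n := fun p => P p.1 + ∑ k, (t₀ * p.2 k) • M k p.1 with hQ
  have hQs : ContDiff ℝ ∞ Q := by
    refine (hP.comp contDiff_fst).add (ContDiff.sum fun k _ => ?_)
    have h1 : ContDiff ℝ ∞ fun p : Euc n × Euc d => p.2 k := (contDiff_euclidean.1 contDiff_snd) k
    exact (contDiff_const.mul h1).smul ((hM k).comp contDiff_fst)
  have hQn : ∀ p ∈ X.bundle Ω, p.1 ∈ W → Q p = X.normalPoint p.1 (t₀ • p.2) := by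
    intro p hp hpW
    obtain ⟨h1, h2⟩ := hPM p.1 ⟨hp.1.1, hpW⟩
    simp [hQ, h1, h2, normalPoint]
  refine ⟨t₀, ht₀, Q ⁻¹' (X.region Ω \ X.carrier) ∩ Prod.fst ⁻¹' (U ∩ W), Q,
    (isOpen_region_diff.preimage hQs.continuous).inter ((hU.inter hW).preimage continuous_fst),
    fun p hp => ⟨?_, hKU hp.1, hKW hp.1⟩, hQs, fun p hp => hp.1, fun p hp => ?_⟩
  · rw [mem_preimage, hQn p ⟨hKb hp.1, hp.2⟩ (hKW hp.1)]
    exact (hreg p.1 ⟨(hKb hp.1).1, hKU hp.1⟩ p.2 hp.2 t₀ ⟨ht₀, le_rfl⟩).1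
  · have h := hQn p hp.2 hp.1.2.2
    rw [h]
    exact ⟨rfl, (hreg p.1 ⟨hp.2.1.1, hp.1.2.1⟩ p.2 hp.2.2 t₀ ⟨ht₀, le_rfl⟩).2⟩

/-- The value of a distribution on a coefficient of the expansion is controlled by the seminorms
of the thick test function. -/
lemma exists_bound_coeff (g : SubDistribution (X.bundle Ω)) (j m : ℤ) {K : Set (Euc n)}
    (hK : IsCompact K) (hKΩ : K ⊆ Ω) : ∃ (q : ℤ) (k : ℕ) (C : ℝ),
    ∀ φ : Euc n → ℂ, ContDiffOn ℝ ∞ φ (Ω \ X.carrier) → (∀ x ∉ K, φ x = 0) →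
      ∀ a, X.IsExpansion Ω m φ a → ∀ B : ℝ, 0 ≤ B →
        (∀ p ∈ Icc m q, ∀ i ≤ k, ∀ x ∈ X.region Ω \ X.carrier,
          ‖iteratedFDeriv ℝ i (X.remainder Ω m φ a p) x‖ ≤ B * X.rho x ^ (p - i)) →
        ∀ b : SubTest (X.bundle Ω), (b : X.bundle Ω → ℂ) = a j →
          ‖g.toLinearMap b‖ ≤ C * B := by
  rcases lt_or_ge j m with hj | hj
  · refine ⟨0, 0, 0, fun φ _ _ a ha B _ _ b hb => ?_⟩
    rw [ha.zero j hj] at hb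
    rw [show b = 0 from Subtype.ext hb]
    simp
  have hK₀ := isCompact_inter_carrier (X := X) hK
  have hK₀b := inter_carrier_subset_base (X := X) hKΩ
  set L := (K ∩ X.carrier) ×ˢ sphere (0 : Euc d) 1 with hL
  have hLc : IsCompact L := hK₀.prod (isCompact_sphere 0 1)
  have hLb : L ⊆ X.bundle Ω := prod_mono hK₀b subset_rfl
  obtain ⟨k, C, hC⟩ := g.bound' L hLc hLb
  obtain ⟨t₀, ht₀, O, Q, hOo, hLO, hQs, hQO, hQn⟩ := exists_smooth_normalPoint hK₀ hK₀b
  obtain ⟨D, hD1, hD⟩ := exists_bound_iteratedFDeriv hQs hLc k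
  set A : ℝ := ∑ i ∈ Finset.range (k + 1), (t₀ ^ (j - i) + t₀ ^ (j + 1 - i)) with hA
  have hA' : ∀ i ≤ k, t₀ ^ (j - i) + t₀ ^ (j + 1 - i) ≤ A := fun i hi =>
    Finset.single_le_sum (f := fun i : ℕ => t₀ ^ (j - i) + t₀ ^ (j + 1 - i))
      (fun i _ => by positivity) (Finset.mem_range.2 (by lia))
  have hA0 : 0 ≤ A := Finset.sum_nonneg fun i _ => by positivity
  refine ⟨j + 1, k, C * (k.factorial * (t₀ ^ (-j) * A) * D ^ k),
    fun φ hφ hφK a ha B hB hbd b hb => ?_⟩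
  -- At radius exactly `t₀` this rescaled term equals `a j`, so `T ∘ Q` is a smooth local extension
  -- of the coefficient.
  set T : Euc n → ℂ := (t₀ ^ (-j)) • X.term Ω (a j) j with hT
  have hterm : ∀ x ∈ X.region Ω \ X.carrier, ContDiffAt ℝ ∞ (X.term Ω (a j) j) x :=
    fun x hx => contDiffAt_term (ha.smooth j) j hx
  have hTs : ContDiffOn ℝ ∞ T (X.region Ω \ X.carrier) := fun x hx =>
    (contDiffAt_const.smul (hterm x hx)).contDiffWithinAt
  have hTQ : ContDiffOn ℝ ∞ (T ∘ Q) O := hTs.comp hQs.contDiffOn hQO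
  have hTb : ∀ p ∈ O, ∀ hp : p ∈ X.bundle Ω, (T ∘ Q) p = a j ⟨p, hp⟩ := by
    intro p hpO hp
    obtain ⟨h1, h2⟩ := hQn p ⟨hpO, hp⟩
    rw [h1] at h2
    rw [Function.comp, h1, hT, Pi.smul_apply, term_normalPoint _ _ hp ht₀ h2, Complex.real_smul,
      mul_left_comm, ← Complex.ofReal_mul, ← zpow_add₀ ht₀.ne']
    simp
  have hazero : ∀ p : X.bundle Ω, (p : Euc n × Euc d) ∉ L → a j p = 0 := fun p hp =>
    ha.coeff_eq_zero hK.isClosed hφK j p fun h => hp ⟨⟨h, p.2.1.1⟩, p.2.2⟩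
  -- The cutoff globalizes the extension. It still agrees with `a j` on the whole bundle: off `L`
  -- the coefficient vanishes, hence so does `T ∘ Q` on the bundle inside `O`, and outside `O` the
  -- cutoff is zero.
  obtain ⟨V, χ, hV, hLV, hVO, hχ0, hχ1, hs⟩ := exists_contDiff_eqOn_of_isCompact hLc hOo hLO hTQ
  have key := hC b (fun p hp => by rw [hb]; exact hazero p hp) _ hs (fun p => ?_)
    (k.factorial * (t₀ ^ (-j) * (A * B)) * D ^ k) (by positivity) (fun i hi p hp => ?_)
  · rw [← mul_assoc _ A B, ← mul_assoc _ _ B, mul_right_comm _ B, ← mul_assoc C _ B] at key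
    exact key
  · rw [hb]
    by_cases hpL : (p : Euc n × Euc d) ∈ L
    · rw [hχ1 _ (hLV hpL), one_smul, hTb _ (hLO hpL) p.2]
    · rw [hazero p hpL]
      by_cases hpO : (p : Euc n × Euc d) ∈ O
      · rw [hTb _ hpO p.2, hazero p hpL, smul_zero]
      · rw [hχ0 _ hpO, zero_smul]
  · have hev : (fun x => χ x • (T ∘ Q) x) =ᶠ[𝓝 p] T ∘ Q := by
      filter_upwards [hV.mem_nhds (hLV hp)] with y hy
      rw [hχ1 y hy, one_smul]
    rw [(hev.iteratedFDeriv ℝ i).eq_of_nhds]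
    have hQp : Q p ∈ X.region Ω \ X.carrier := hQO (hLO hp)
    refine norm_iteratedFDeriv_comp_le_of_isOpen isOpen_region_diff hTs hQs hQp hD1
      (fun l hl => ?_) (fun l hl => hD l hl p hp) i hi
    have hρ : X.rho (Q p) = t₀ := by
      obtain ⟨h1, h2⟩ := hQn p ⟨hLO hp, hLb hp⟩
      rw [h1] at h2 ⊢
      exact rho_normalPoint hp.1.2 hp.2 ht₀ h2
    have hle : (l : ℕ∞ω) ≤ ∞ := (natCast_lt_infty l).le
    rw [hT, iteratedFDeriv_const_smul_apply ((hterm _ hQp).of_le hle), norm_smul,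
      Real.norm_of_nonneg (by positivity)]
    gcongr
    rw [term_eq_remainder_sub hj φ a, iteratedFDeriv_sub_apply
      ((contDiffAt_remainder hφ ha.smooth j hQp).of_le hle)
      ((contDiffAt_remainder hφ ha.smooth (j + 1) hQp).of_le hle)]
    have h1 := hbd j ⟨hj, by lia⟩ l hl _ hQp
    have h2 := hbd (j + 1) ⟨by lia, le_rfl⟩ l hl _ hQp
    rw [hρ] at h1 h2
    calc _ ≤ _ := norm_sub_le _ _
      _ ≤ B * t₀ ^ (j - l) + B * t₀ ^ (j + 1 - l) := add_le_add h1 h2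
      _ = (t₀ ^ (j - l) + t₀ ^ (j + 1 - l)) * B := by ring
      _ ≤ A * B := by
        gcongr
        exact hA' l hl

lemma exists_coeff (φ : X.ThickTest Ω) :
    ∃ a, (∃ m, X.IsExpansion Ω m (φ : Euc n → ℂ) a) ∧ ∀ j, a j ∈ SubTest (X.bundle Ω) := by
  obtain ⟨-, -, ⟨K, hK, hKΩ, hφ⟩, m, a, ha⟩ := φ.2
  exact ⟨a, ⟨m, ha⟩, ha.coeff_mem hK hKΩ hφ⟩

/-- The coefficients of the expansion of a thick test function. -/
noncomputable def coeff (φ : X.ThickTest Ω) (j : ℤ) : SubTest (X.bundle Ω) :=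
  ⟨(exists_coeff φ).choose j, (exists_coeff φ).choose_spec.2 j⟩

lemma exists_isExpansion_coeff (φ : X.ThickTest Ω) :
    ∃ m, X.IsExpansion Ω m (φ : Euc n → ℂ) fun j => (coeff φ j : X.bundle Ω → ℂ) :=
  (exists_coeff φ).choose_spec.1

/-- Uniqueness makes the chosen coefficients independent of the choice; linearity of the thick delta
rests on this. -/
lemma coeff_eq {φ : X.ThickTest Ω} {m : ℤ} {a : ℤ → X.bundle Ω → ℂ}
    (h : X.IsExpansion Ω m (φ : Euc n → ℂ) a) (j : ℤ) : (coeff φ j : X.bundle Ω → ℂ) = a j := by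
  obtain ⟨m', h'⟩ := exists_isExpansion_coeff φ
  exact congrFun (h'.coeff_unique h) j

/-- The thick delta function of degree `j`. -/
noncomputable def thickDelta (g : SubDistribution (X.bundle Ω)) (j : ℤ) :
    X.ThickDistribution Ω where
  toFun φ := (sphereArea d : ℂ)⁻¹ * g.toLinearMap (coeff φ j)
  map_add' φ ψ := by
    rw [← mul_add, ← map_add]
    congr 2
    obtain ⟨m, h⟩ := exists_isExpansion_coeff φ
    obtain ⟨m', h'⟩ := exists_isExpansion_coeff ψ
    have hadd := (h.mono (min_le_left m m')).add φ.2.1 ψ.2.1 (h'.mono (min_le_right m m'))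
    exact Subtype.ext (coeff_eq (φ := φ + ψ) hadd j)
  map_smul' c φ := by
    obtain ⟨m, h⟩ := exists_isExpansion_coeff φ
    have : coeff (c • φ) j = c • coeff φ j := 
      Subtype.ext (coeff_eq (φ := c • φ) (h.smul c φ.2.1) j)
    rw [this, map_smul, RingHom.id_apply, smul_eq_mul, smul_eq_mul, mul_left_comm]
  bound' m K hK hKΩ := by
    obtain ⟨q, k, C, hC⟩ := exists_bound_coeff g j m hK hKΩ
    refine ⟨q, k, ‖(sphereArea d : ℂ)⁻¹‖ * C, fun φ hφ a ha B hB hbd _ => ?_⟩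
    change ‖(sphereArea d : ℂ)⁻¹ * g.toLinearMap (coeff φ j)‖ ≤ _
    rw [norm_mul, mul_assoc]
    gcongr
    exact hC φ φ.2.1 hφ a ha B hB hbd _ (coeff_eq ha j)

lemma isThickDelta_thickDelta (g : SubDistribution (X.bundle Ω)) (j : ℤ) :
    IsThickDelta g j (thickDelta g j) :=
  fun φ _ _ ha => ⟨coeff φ j, coeff_eq ha j, rfl⟩

lemma IsThickDelta.unique {g : SubDistribution (X.bundle Ω)} {j : ℤ}
    {T T' : X.ThickDistribution Ω} (h : IsThickDelta g j T) (h' : IsThickDelta g j T') :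
    T = T' := by
  have : T.toLinearMap = T'.toLinearMap := by
    ext φ
    obtain ⟨m, ha⟩ := exists_isExpansion_coeff φ
    obtain ⟨b, hb, hT⟩ := h φ m _ ha
    obtain ⟨b', hb', hT'⟩ := h' φ m _ ha
    rw [hT, hT', Subtype.ext (hb.trans hb'.symm)]
  cases T
  cases T'
  congr

end FramedSubmanifold

/-! ### Linearity and bounds for mixed partial derivatives -/

section MixedPartialBounds

variable {n d : ℕ}

lemma mixedPartial_add (α : Fin d → ℕ) {f g : Euc d → ℂ} (hf : ContDiff ℝ ∞ f)
    (hg : ContDiff ℝ ∞ g) : mixedPartial α (f + g) = mixedPartial α f + mixedPartial α g := by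
  have h := fun F : SmoothFun (Euc d) => coe_prod_dirDeriv α F (List.finRange d)
  have h1 := h (⟨f, hf⟩ + ⟨g, hg⟩)
  rw [map_add, Submodule.coe_add, h, h] at h1
  exact h1.symm

lemma partialDeriv_const_smul (k : Fin d) (c : ℂ) (f : Euc d → ℂ) :
    partialDeriv k (c • f) = c • partialDeriv k f := by
  funext y
  simp [partialDeriv, fderiv_const_smul_field]

lemma mixedPartial_const_smul (α : Fin d → ℕ) (c : ℂ) (f : Euc d → ℂ) :
    mixedPartial α (c • f) = c • mixedPartial α f := by
  unfold mixedPartial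
  induction List.finRange d with
  | nil => rfl
  | cons k l ih =>
    simp only [List.foldr_cons, ih]
    induction α k with
    | zero => rfl
    | succ r ihr => simp only [Function.iterate_succ_apply', ihr, partialDeriv_const_smul]

lemma norm_iteratedFDeriv_partialDeriv_le (k : Fin d) {H : Euc n → Euc d → ℂ}
    (hH : ContDiff ℝ ∞ (Function.uncurry H)) (i : ℕ) (p : Euc n × Euc d) :
    ‖iteratedFDeriv ℝ i (Function.uncurry fun x => partialDeriv k (H x)) p‖ ≤
      ‖iteratedFDeriv ℝ (i + 1) (Function.uncurry H) p‖ := by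
  have h1 : (Function.uncurry fun x => partialDeriv k (H x)) =
      fun q => fderiv ℝ (Function.uncurry H) q (0, EuclideanSpace.single k 1) := by
    funext ⟨x, y⟩
    have h2 : HasFDerivAt (Function.uncurry H) (fderiv ℝ (Function.uncurry H) (x, y)) (x, y) :=
      (hH.contDiffAt.differentiableAt (by simp)).hasFDerivAt
    have h3 : HasFDerivAt (H x) ((fderiv ℝ (Function.uncurry H) (x, y)).comp
        (ContinuousLinearMap.inr ℝ (Euc n) (Euc d))) y :=
      h2.comp y (hasFDerivAt_prodMk_right x y)
    simp [partialDeriv, h3.fderiv]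
  have h4 : ‖((0 : Euc n), (EuclideanSpace.single k 1 : Euc d))‖ = 1 := by
    simp [Prod.norm_def]
  have h5 := norm_iteratedFDeriv_clm_apply_const (n := i) (N := ∞) (x := p)
    (c := ((0 : Euc n), (EuclideanSpace.single k 1 : Euc d)))
    (hH.fderiv_right (m := ∞) (by simp)).contDiffAt (natCast_lt_infty i).le
  rw [h4, one_mul, norm_iteratedFDeriv_fderiv] at h5
  rw [h1]
  exact h5

/-- Each partial derivative in `y` is a full derivative applied to a unit vector, so it costs one
order and no constant. -/
lemma norm_iteratedFDeriv_mixedPartial_le (α : Fin d → ℕ) {H : Euc n → Euc d → ℂ}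
    (hH : ContDiff ℝ ∞ (Function.uncurry H)) (i : ℕ) (p : Euc n × Euc d) :
    ‖iteratedFDeriv ℝ i (Function.uncurry fun x => mixedPartial α (H x)) p‖ ≤
      ‖iteratedFDeriv ℝ (i + ∑ k, α k) (Function.uncurry H) p‖ := by
  have hsum : ∑ k, α k = ((List.finRange d).map α).sum := by
    rw [← List.sum_ofFn, List.ofFn_eq_map]
  rw [hsum]
  unfold mixedPartial
  suffices hs : ContDiff ℝ ∞ (Function.uncurry fun x =>
      (List.finRange d).foldr (fun k h => (partialDeriv k)^[α k] h) (H x)) ∧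
      ∀ i, ‖iteratedFDeriv ℝ i (Function.uncurry fun x =>
        (List.finRange d).foldr (fun k h => (partialDeriv k)^[α k] h) (H x)) p‖ ≤
        ‖iteratedFDeriv ℝ (i + ((List.finRange d).map α).sum) (Function.uncurry H) p‖ from hs.2 i
  induction List.finRange d with
  | nil => exact ⟨hH, fun i => le_rfl⟩
  | cons k l ih =>
    simp only [List.foldr_cons]
    rw [List.map_cons, List.sum_cons]
    induction α k with
    | zero =>
      rw [zero_add]
      exact ih
    | succ r ihr =>
      simp only [Function.iterate_succ_apply']
      refine ⟨contDiff_partialDeriv k ihr.1, fun i => ?_⟩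
      refine (norm_iteratedFDeriv_partialDeriv_le k ihr.1 i p).trans ?_
      rw [show i + (r + 1 + (l.map α).sum) = i + 1 + (r + (l.map α).sum) by ring]
      exact ihr.2 (i + 1)

lemma norm_iteratedFDeriv_slice_le {f : Euc n × Euc d → ℂ} (hf : ContDiff ℝ ∞ f) (i : ℕ)
    (x : Euc n) : ‖iteratedFDeriv ℝ i (fun x => f (x, 0)) x‖ ≤ ‖iteratedFDeriv ℝ i f (x, 0)‖ := by
  have h := ContinuousLinearMap.iteratedFDeriv_comp_right
    (ContinuousLinearMap.inl ℝ (Euc n) (Euc d)) hf x (natCast_lt_infty i).le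
  change ‖iteratedFDeriv ℝ i (f ∘ ContinuousLinearMap.inl ℝ (Euc n) (Euc d)) x‖ ≤ _
  rw [h]
  refine (ContinuousMultilinearMap.norm_compContinuousLinearMap_le _ _).trans ?_
  exact mul_le_of_le_one_right (norm_nonneg _) (Finset.prod_le_one (fun _ _ => norm_nonneg _)
    fun _ _ => ContinuousLinearMap.norm_inl_le_one ℝ (Euc n) (Euc d))

end MixedPartialBounds

/-! ### Multilayers -/

namespace FramedSubmanifold

variable {n d : ℕ} {X : FramedSubmanifold n d} {Ω : TopologicalSpace.Opens (Euc n)}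

lemma contDiff_comp_normal {φ : Euc n → ℂ} (hφ : ContDiff ℝ ∞ φ) (ξ : Euc n) :
    ContDiff ℝ ∞ fun y : Euc d => φ (ξ + ∑ k, y k • X.frame k ξ) := by
  refine hφ.comp (contDiff_const.add (ContDiff.sum fun k _ => ?_))
  have h : ContDiff ℝ ∞ fun y : Euc d => y k := (contDiff_euclidean.1 contDiff_id) k
  exact h.smul contDiff_const

lemma normalDeriv_add (α : Fin d → ℕ) {φ ψ : Euc n → ℂ} (hφ : ContDiff ℝ ∞ φ)
    (hψ : ContDiff ℝ ∞ ψ) :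
    X.normalDeriv Ω α (φ + ψ) = X.normalDeriv Ω α φ + X.normalDeriv Ω α ψ := by
  funext ξ
  exact congrFun (mixedPartial_add α (contDiff_comp_normal hφ ξ) (contDiff_comp_normal hψ ξ)) 0

lemma normalDeriv_const_smul (α : Fin d → ℕ) (c : ℂ) (φ : Euc n → ℂ) :
    X.normalDeriv Ω α (c • φ) = c • X.normalDeriv Ω α φ := by
  funext ξ
  exact congrFun (mixedPartial_const_smul α c fun y : Euc d => φ (ξ + ∑ k, y k • X.frame k ξ)) 0

lemma normalDeriv_eq_zero (α : Fin d → ℕ) {φ : Euc n → ℂ} {ξ : X.base Ω}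
    (h : φ =ᶠ[𝓝 (ξ : Euc n)] 0) : X.normalDeriv Ω α φ ξ = 0 := by
  have hten : Tendsto (fun y : Euc d => (ξ : Euc n) + ∑ k, y k • X.frame k ξ) (𝓝 0)
      (𝓝 (ξ : Euc n)) := by
    have hcont : Continuous fun y : Euc d => (ξ : Euc n) + ∑ k, y k • X.frame k ξ := by
      fun_prop
    simpa using hcont.tendsto 0
  exact (mixedPartial_eventuallyEq_zero α (h.comp_tendsto hten)).self_of_nhds

/-- The value of a distribution on a normal derivative of a test function is controlled by the
derivatives of the test function. -/
lemma exists_bound_normalDeriv (h : SubDistribution (X.base Ω)) (α : Fin d → ℕ)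
    {K : Set (Euc n)} (hK : IsCompact K) (hKΩ : K ⊆ Ω) : ∃ (N : ℕ) (C : ℝ), 0 ≤ C ∧
    ∀ φ : Euc n → ℂ, ContDiff ℝ ∞ φ → (∀ x ∉ K, φ x = 0) → ∀ B : ℝ, 0 ≤ B →
      (∀ i ≤ N, ∀ x, ‖iteratedFDeriv ℝ i φ x‖ ≤ B) →
      ∀ b : SubTest (X.base Ω), (b : X.base Ω → ℂ) = X.normalDeriv Ω α φ →
        ‖h.toLinearMap b‖ ≤ C * B := by
  have hK₀ := isCompact_inter_carrier (X := X) hK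
  have hK₀b := inter_carrier_subset_base (X := X) hKΩ
  obtain ⟨k, C, hC⟩ := h.bound' _ hK₀ hK₀b
  obtain ⟨W, P, M, hW, hKW, hP, hM, hPM⟩ := exists_smooth_extension hK₀ inter_subset_right
  have hE : ContDiff ℝ ∞ fun p : Euc n × Euc d => P p.1 + ∑ k, p.2 k • M k p.1 := by
    refine (hP.comp contDiff_fst).add (ContDiff.sum fun k _ => ?_)
    have h1 : ContDiff ℝ ∞ fun p : Euc n × Euc d => p.2 k := (contDiff_euclidean.1 contDiff_snd) k
    exact h1.smul ((hM k).comp contDiff_fst)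
  -- The distribution has order `k` on the compact set, and `D_𝐧^α` uses up `|α|` further
  -- derivatives of `φ`.
  set N := k + ∑ k, α k with hN
  obtain ⟨D, hD1, hD⟩ := exists_bound_iteratedFDeriv hE
    (hK₀.prod (isCompact_singleton (x := (0 : Euc d)))) N
  refine ⟨N, |C| * (N.factorial * D ^ N), by positivity, fun φ hφ hφK B hB hbd b hb => ?_⟩
  set H : Euc n → Euc d → ℂ := fun x y => φ (P x + ∑ k, y k • M k x) with hH
  have hHs : ContDiff ℝ ∞ (Function.uncurry H) := hφ.comp hE
  have hmix := contDiff_mixedPartial α hHs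
  have hf : ContDiff ℝ ∞ fun x => mixedPartial α (H x) 0 :=
    hmix.comp (contDiff_id.prodMk contDiff_const)
  obtain ⟨V, χ, hV, hKV, -, hχ0, hχ1, hs⟩ :=
    exists_contDiff_eqOn_of_isCompact hK₀ hW hKW hf.contDiffOn
  have hfb : ∀ x : X.base Ω, (x : Euc n) ∈ W →
      mixedPartial α (H x) 0 = X.normalDeriv Ω α φ x := by
    intro x hx
    obtain ⟨h1, h2⟩ := hPM x ⟨x.2.1, hx⟩
    simp only [hH, h1, h2, normalDeriv]
  have hzero : ∀ x : X.base Ω, (x : Euc n) ∉ K ∩ X.carrier → X.normalDeriv Ω α φ x = 0 := by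
    intro x hx
    refine normalDeriv_eq_zero α ?_
    filter_upwards [hK.isClosed.isOpen_compl.mem_nhds fun h => hx ⟨h, x.2.1⟩] with y hy
      using hφK y hy
  have key := hC b (fun x hx => by rw [hb]; exact hzero x hx) _ hs (fun x => ?_)
    (N.factorial * B * D ^ N) (by positivity) (fun i hi x hx => ?_)
  · refine key.trans ?_
    rw [mul_right_comm _ B, ← mul_assoc C]
    gcongr
    exact le_abs_self C
  · rw [hb]
    by_cases hxK : (x : Euc n) ∈ K ∩ X.carrier
    · rw [hχ1 _ (hKV hxK), one_smul, hfb x (hKW hxK)]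
    · rw [hzero x hxK]
      by_cases hxW : (x : Euc n) ∈ W
      · rw [hfb x hxW, hzero x hxK, smul_zero]
      · rw [hχ0 _ hxW, zero_smul]
  · have hev : (fun x => χ x • mixedPartial α (H x) 0) =ᶠ[𝓝 x] fun x => mixedPartial α (H x) 0 := by
      filter_upwards [hV.mem_nhds (hKV hx)] with y hy
      rw [hχ1 y hy, one_smul]
    rw [(hev.iteratedFDeriv ℝ i).eq_of_nhds]
    refine (norm_iteratedFDeriv_slice_le hmix i x).trans
      ((norm_iteratedFDeriv_mixedPartial_le α hHs i _).trans ?_)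
    exact norm_iteratedFDeriv_comp_le_of_isOpen isOpen_univ hφ.contDiffOn hE (mem_univ _) hD1
      (fun l hl => hbd l hl _) (fun l hl => hD l hl _ ⟨hx, mem_singleton _⟩) _ (by lia)

/-- The multilayer `D̄_𝐧^α(h δ_Σ)`. -/
noncomputable def multilayer (h : SubDistribution (X.base Ω)) (α : Fin d → ℕ) :
    𝓓(Ω, ℂ) →L[ℂ] ℂ :=
  TestFunction.mkCLM ℂ
    (fun φ => (-1) ^ (∑ k, α k) * h.toLinearMap ⟨X.normalDeriv Ω α φ, normalDeriv_mem α φ⟩)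
    (fun φ ψ => by
      rw [← mul_add, ← map_add]
      congr 2
      exact Subtype.ext (normalDeriv_add α φ.contDiff ψ.contDiff))
    (fun c φ => by
      rw [smul_eq_mul, mul_left_comm, ← smul_eq_mul c, ← map_smul]
      congr 2
      exact Subtype.ext (normalDeriv_const_smul α c φ))
    (fun K hK => by
      obtain ⟨N, C, hC0, hC⟩ := exists_bound_normalDeriv h α K.isCompact hK
      let A : 𝓓_{K}(Euc n, ℂ) →L[ℂ] ℂ := ContDiffMapSupportedIn.mkCLMtoNormedSpace ℂ
        (fun φ => (-1) ^ (∑ k, α k) * h.toLinearMap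
          ⟨X.normalDeriv Ω α (TestFunction.ofSupportedIn hK φ), normalDeriv_mem α _⟩)
        (fun φ ψ => by
          rw [← mul_add, ← map_add]
          congr 2
          exact Subtype.ext (normalDeriv_add α φ.contDiff ψ.contDiff))
        (fun c φ => by
          rw [smul_eq_mul, mul_left_comm, ← smul_eq_mul c, ← map_smul]
          congr 2
          exact Subtype.ext (normalDeriv_const_smul α c φ))
        ⟨Finset.range (N + 1), C, hC0, fun φ => by
          rw [norm_mul, norm_pow, norm_neg, norm_one, one_pow, one_mul]
          refine hC φ φ.contDiff (fun x hx => φ.zero_on_compl hx) _ (apply_nonneg _ _)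
            (fun i hi x => ?_) _ rfl
          refine (ContDiffMapSupportedIn.norm_iteratedFDeriv_apply_le_seminorm_top ℂ).trans ?_
          have hiN : i ∈ Finset.range (N + 1) := Finset.mem_range.2 (by lia)
          exact Seminorm.le_finset_sup_apply hiN⟩
      exact A.continuous)

lemma isMultilayer_multilayer (h : SubDistribution (X.base Ω)) (α : Fin d → ℕ) :
    IsMultilayer h α (multilayer h α) := fun _ => rfl

lemma IsMultilayer.unique {h : SubDistribution (X.base Ω)} {α : Fin d → ℕ}
    {L L' : 𝓓(Ω, ℂ) →L[ℂ] ℂ} (hL : IsMultilayer h α L) (hL' : IsMultilayer h α L') : L = L' := by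
  ext φ
  rw [hL, hL']

/-! ### Taylor expansion in the normal directions -/

variable (X) in
/-- The derivative `D_𝐧^α φ` as a function of the ambient space. -/
noncomputable def ambientNormalDeriv (α : Fin d → ℕ) (φ : Euc n → ℂ) (ξ : Euc n) : ℂ :=
  mixedPartial α (fun y : Euc d => φ (ξ + ∑ k, y k • X.frame k ξ)) 0

lemma smoothOnSubset_ambientNormalDeriv (α : Fin d → ℕ) {φ : Euc n → ℂ} (hφ : ContDiff ℝ ∞ φ) :
    SmoothOnSubset X.carrier (X.ambientNormalDeriv α φ) := by
  intro ξ hξ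
  obtain ⟨W, P, M, hW, hKW, hP, hM, hPM⟩ :=
    exists_smooth_extension (isCompact_singleton (x := ξ)) (singleton_subset_iff.2 hξ)
  have hH : ContDiff ℝ ∞ (Function.uncurry fun (x : Euc n) (y : Euc d) =>
      φ (P x + ∑ k, y k • M k x)) := by
    refine hφ.comp ((hP.comp contDiff_fst).add (ContDiff.sum fun k _ => ?_))
    have h1 : ContDiff ℝ ∞ fun p : Euc n × Euc d => p.2 k := (contDiff_euclidean.1 contDiff_snd) k
    exact h1.smul ((hM k).comp contDiff_fst)
  refine ⟨_, (contDiff_mixedPartial α hH).comp (contDiff_id.prodMk (contDiff_const (c := 0))), ?_⟩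
  filter_upwards [self_mem_nhdsWithin,
    mem_nhdsWithin_of_mem_nhds (hW.mem_nhds (singleton_subset_iff.1 hKW))] with x hxS hxW
  obtain ⟨h1, h2⟩ := hPM x ⟨hxS, hxW⟩
  simp only [ambientNormalDeriv, Function.comp, Function.uncurry, id, h1, h2]

lemma ambientNormalDeriv_eq_zero (α : Fin d → ℕ) {φ : Euc n → ℂ} {ξ : Euc n}
    (h : φ =ᶠ[𝓝 ξ] 0) : X.ambientNormalDeriv α φ ξ = 0 := by
  have hten : Tendsto (fun y : Euc d => ξ + ∑ k, y k • X.frame k ξ) (𝓝 0) (𝓝 ξ) := by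
    have hcont : Continuous fun y : Euc d => ξ + ∑ k, y k • X.frame k ξ := by fun_prop
    simpa using hcont.tendsto 0
  exact (mixedPartial_eventuallyEq_zero α (h.comp_tendsto hten)).self_of_nhds

variable (X) in
/-- The term of degree `l` of the Taylor expansion of `φ` in the normal directions. -/
noncomputable def taylorTerm (φ : Euc n → ℂ) (l : ℕ) (x : Euc n) : ℂ :=
  ∑ α ∈ Finset.piAntidiag Finset.univ l, ((∏ k, (α k).factorial : ℕ) : ℂ)⁻¹ *
    (X.ambientNormalDeriv α φ (X.proj x) *
      ∏ k, ((inner ℝ (X.frame k (X.proj x)) (x - X.proj x) : ℝ) : ℂ) ^ α k)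

variable (X) in
/-- The remainder of order `q` of the Taylor expansion of `φ` in the normal directions. -/
noncomputable def taylorRemainder (φ : Euc n → ℂ) (q : ℕ) (x : Euc n) : ℂ :=
  φ x - ∑ l ∈ Finset.range q, X.taylorTerm φ l x

lemma contDiffAt_taylorTerm {φ : Euc n → ℂ} (hφ : ContDiff ℝ ∞ φ) (l : ℕ) {x : Euc n}
    (hx : x ∈ tube X.carrier X.eps) : ContDiffAt ℝ ∞ (X.taylorTerm φ l) x := by
  refine ContDiffAt.sum fun α _ => contDiffAt_const.mul
    ((contDiffAt_comp_proj (smoothOnSubset_ambientNormalDeriv α hφ) hx).mul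
      (contDiffAt_prod fun k _ => ContDiffAt.pow ?_ _))
  exact Complex.ofRealCLM.contDiff.contDiffAt.comp x
    ((contDiffAt_frame_proj k hx).inner ℝ (contDiffAt_id.sub (contDiffAt_proj hx)))

lemma contDiffOn_taylorRemainder {φ : Euc n → ℂ} (hφ : ContDiff ℝ ∞ φ) (q : ℕ) :
    ContDiffOn ℝ ∞ (X.taylorRemainder φ q) (tube X.carrier X.eps) := fun _ hx =>
  (hφ.contDiffAt.sub (ContDiffAt.sum fun l _ => contDiffAt_taylorTerm hφ l hx)).contDiffWithinAt

/-- Orthonormality of the frame makes `y ↦ ∑ yₖ 𝐧ₖ(ξ)` a linear isometry, so slicing does not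
increase derivatives, uniformly in `ξ`. -/
lemma norm_iteratedFDeriv_comp_normal_le {φ : Euc n → ℂ} (hφ : ContDiff ℝ ∞ φ) {ξ : Euc n}
    (hξ : ξ ∈ X.carrier) (q : ℕ) (y : Euc d) :
    ‖iteratedFDeriv ℝ q (fun y : Euc d => φ (ξ + ∑ k, y k • X.frame k ξ)) y‖ ≤
      ‖iteratedFDeriv ℝ q φ (ξ + ∑ k, y k • X.frame k ξ)‖ := by
  let A : Euc d →L[ℝ] Euc n := ∑ k, (EuclideanSpace.proj (𝕜 := ℝ) k).smulRight (X.frame k ξ)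
  have hA : ∀ y : Euc d, A y = ∑ k, y k • X.frame k ξ := by
    intro y
    simp [A]
  have hA1 : ‖A‖ ≤ 1 := A.opNorm_le_bound zero_le_one fun y => by
    rw [hA, norm_sum_smul_frame hξ, one_mul]
  have hφ' : ContDiff ℝ ∞ fun z => φ (ξ + z) := hφ.comp (contDiff_const.add contDiff_id)
  have h := A.iteratedFDeriv_comp_right hφ' y (natCast_lt_infty q).le
  have h1 : (fun z => φ (ξ + z)) ∘ A = fun y : Euc d => φ (ξ + ∑ k, y k • X.frame k ξ) := by
    funext y
    simp only [Function.comp, hA]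
  rw [h1] at h
  rw [h]
  refine (ContinuousMultilinearMap.norm_compContinuousLinearMap_le _ _).trans ?_
  rw [iteratedFDeriv_comp_add_left, hA]
  exact mul_le_of_le_one_right (norm_nonneg _)
    (Finset.prod_le_one (fun _ _ => norm_nonneg _) fun _ _ => hA1)

/-- Taylor's formula at `0` in the normal slice through `π(x)`, evaluated at the frame coordinates
of `x - π(x)`, whose norm is `ρ_x`. -/
lemma norm_taylorRemainder_le {φ : Euc n → ℂ} (hφ : ContDiff ℝ ∞ φ) (q : ℕ) {M : ℝ}
    (hM : ∀ x, ‖iteratedFDeriv ℝ q φ x‖ ≤ M) {x : Euc n} (hx : x ∈ tube X.carrier X.eps) :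
    ‖X.taylorRemainder φ q x‖ ≤ M * ‖x - X.proj x‖ ^ q := by
  have hp := X.isTubular.proj_mem x hx
  set y : Euc d := WithLp.toLp 2 fun k => inner ℝ (X.frame k (X.proj x)) (x - X.proj x) with hy
  have hsum : ∑ k, y k • X.frame k (X.proj x) = x - X.proj x := sum_inner_smul_frame hx
  have hf := contDiff_comp_normal (X := X) hφ (X.proj x)
  have h := norm_sub_taylor_le hf q (x := 0) (y := y) fun t _ =>
    (norm_iteratedFDeriv_comp_normal_le hφ hp q _).trans (hM _)
  rw [zero_add, hsum, add_sub_cancel, ← norm_sum_smul_frame hp, hsum] at h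
  have hterm : ∀ l, (l.factorial : ℝ)⁻¹ • iteratedFDeriv ℝ l
      (fun y : Euc d => φ (X.proj x + ∑ k, y k • X.frame k (X.proj x))) 0 (fun _ => y) =
      X.taylorTerm φ l x := fun l =>
    iteratedFDeriv_diagonal_eq_sum_mixedPartial ⟨_, hf⟩ l 0 y
  simp only [hterm] at h
  exact h

lemma exists_bound_iteratedFDeriv_of_hasCompactSupport {φ : Euc n → ℂ} (hφ : ContDiff ℝ ∞ φ)
    (hc : HasCompactSupport φ) (q : ℕ) : ∃ M : ℝ, ∀ x, ‖iteratedFDeriv ℝ q φ x‖ ≤ M :=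
  (hφ.continuous_iteratedFDeriv (natCast_lt_infty q).le).bounded_above_of_compact_support
    (hc.iteratedFDeriv q)

/-- The bound in powers of `ρ_x` is also one in powers of `‖x - ξ‖`, since `π(x)` is the closest
point; smoothness then forces vanishing to order `q`, tangential derivatives included. -/
lemma iteratedFDeriv_taylorRemainder_eq_zero {φ : Euc n → ℂ} (hφ : ContDiff ℝ ∞ φ)
    (hc : HasCompactSupport φ) (q : ℕ) {ξ : Euc n} (hξ : ξ ∈ X.carrier) :
    ∀ l < q, iteratedFDeriv ℝ l (X.taylorRemainder φ q) ξ = 0 := by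
  intro l hl
  have hξt := mem_tube_of_mem hξ
  obtain ⟨V, χ, hV, hξV, -, -, hχ1, hs⟩ := exists_contDiff_eqOn_of_isCompact
    (isCompact_singleton (x := ξ)) isOpen_tube (singleton_subset_iff.2 hξt)
    (contDiffOn_taylorRemainder (X := X) hφ q)
  have hev : (fun x => χ x • X.taylorRemainder φ q x) =ᶠ[𝓝 ξ] X.taylorRemainder φ q := by
    filter_upwards [hV.mem_nhds (singleton_subset_iff.1 hξV)] with y hy
    rw [hχ1 y hy, one_smul]
  rw [← (hev.iteratedFDeriv ℝ l).eq_of_nhds]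
  refine iteratedFDeriv_eq_zero_of_isBigO hs ?_ l hl
  obtain ⟨M, hM⟩ := exists_bound_iteratedFDeriv_of_hasCompactSupport hφ hc q
  have hM0 : 0 ≤ M := (norm_nonneg _).trans (hM 0)
  refine Asymptotics.IsBigO.of_bound M ?_
  filter_upwards [hev, isOpen_tube.mem_nhds hξt] with x hx hxt
  rw [hx, norm_pow, norm_norm]
  refine (norm_taylorRemainder_le hφ q hM hxt).trans ?_
  gcongr
  exact norm_sub_proj_le hxt hξ

/-- The segments from the points of the tube, away from its boundary and over a compact set, to
their projections fill a compact part of the tube. -/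
lemma exists_isCompact_segment_subset {κ : Set (Euc n)} (hκ : IsCompact κ) :
    ∃ (W : Set (Euc n)) (R : ℝ), IsCompact W ∧ W ⊆ tube X.carrier X.eps ∧ 1 ≤ R ∧
      ∀ x ∈ tube X.carrier X.eps, X.rho x < X.eps (X.proj x) / 2 → (x ∈ κ ∨ X.proj x ∈ κ) →
        segment ℝ (X.proj x) x ⊆ W ∧ X.rho x ≤ R := by
  rcases X.carrier.eq_empty_or_nonempty with hS | ⟨ξ₀, hξ₀⟩
  · refine ⟨∅, 1, isCompact_empty, empty_subset _, le_rfl, fun x hx => ?_⟩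
    have := X.isTubular.proj_mem x hx
    simp [hS] at this
  have hSc := X.isClosedSubmanifold.isClosed
  obtain ⟨r, hr0, hr⟩ : ∃ r > (0 : ℝ), ∀ x ∈ κ, ‖x‖ ≤ r := hκ.isBounded.exists_pos_norm_le
  obtain ⟨e, he⟩ := (isCompact_inter_carrier (X := X) hκ).exists_bound_of_continuousOn
    (X.isTubular.eps_cont.mono inter_subset_right)
  -- A closed set containing the relevant pairs `(x, π(x))`. Comparison with the fixed point `ξ₀`
  -- bounds it when `x ∈ κ`; boundedness of `ε` on `κ` does so when `π(x) ∈ κ`. The factor `1/2`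
  -- leaves the closed condition strictly inside the tube.
  set Z : Set (Euc n × Euc n) := {p | p.2 ∈ X.carrier ∧ ‖p.1 - p.2‖ ≤ X.eps p.2 / 2 ∧
    ‖p.1 - p.2‖ ≤ ‖p.1 - ξ₀‖ ∧ (p.1 ∈ κ ∨ p.2 ∈ κ)} with hZ
  set R : ℝ := 1 + 2 * r + ‖ξ₀‖ + |e| with hR
  have hZR : ∀ p ∈ Z, ‖p.1‖ ≤ R ∧ ‖p.2‖ ≤ R ∧ ‖p.1 - p.2‖ ≤ R := by
    rintro ⟨x, ξ⟩ ⟨h1, h2, h3, h4 | h4⟩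
    · have h5 := hr x h4
      have h6 : ‖x - ξ‖ ≤ r + ‖ξ₀‖ := h3.trans ((norm_sub_le _ _).trans (by simpa using h5))
      have h7 : ‖ξ‖ ≤ ‖x‖ + ‖x - ξ‖ := by
        simpa using norm_sub_le x (x - ξ)
      simp only
      refine ⟨?_, ?_, ?_⟩ <;> linarith [abs_nonneg e, norm_nonneg ξ₀]
    · have h5 := hr ξ h4
      have h6 : ‖x - ξ‖ ≤ |e| := by
        have h8 := (Real.le_norm_self _).trans ((he ξ ⟨h4, h1⟩).trans (le_abs_self e))
        have h9 := X.isTubular.eps_pos ξ h1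
        simp only at h2
        linarith
      have h7 : ‖x‖ ≤ ‖ξ‖ + ‖x - ξ‖ := by
        simpa using norm_add_le ξ (x - ξ)
      simp only
      refine ⟨?_, ?_, ?_⟩ <;> linarith [abs_nonneg e, norm_nonneg ξ₀]
  have hZc : IsCompact Z := by
    refine Metric.isCompact_of_isClosed_isBounded ?_ ?_
    · have hc1 : IsClosed (Prod.snd ⁻¹' X.carrier ∩
          (fun p : Euc n × Euc n => X.eps p.2 / 2 - ‖p.1 - p.2‖) ⁻¹' Ici 0) := by
        refine ContinuousOn.preimage_isClosed_of_isClosed ?_ (hSc.preimage continuous_snd)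
          isClosed_Ici
        refine ContinuousOn.sub ?_ (by fun_prop)
        exact (X.isTubular.eps_cont.comp continuousOn_snd fun p hp => hp).div_const 2
      have hc2 : IsClosed {p : Euc n × Euc n | ‖p.1 - p.2‖ ≤ ‖p.1 - ξ₀‖} :=
        isClosed_le (by fun_prop) (by fun_prop)
      have hc3 : IsClosed {p : Euc n × Euc n | p.1 ∈ κ ∨ p.2 ∈ κ} :=
        (hκ.isClosed.preimage continuous_fst).union (hκ.isClosed.preimage continuous_snd)
      have hZeq : Z = (Prod.snd ⁻¹' X.carrier ∩
          (fun p : Euc n × Euc n => X.eps p.2 / 2 - ‖p.1 - p.2‖) ⁻¹' Ici 0) ∩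
          ({p | ‖p.1 - p.2‖ ≤ ‖p.1 - ξ₀‖} ∩ {p | p.1 ∈ κ ∨ p.2 ∈ κ}) := by
        ext p
        exact ⟨fun h => ⟨⟨h.1, sub_nonneg.2 h.2.1⟩, h.2.2.1, h.2.2.2⟩,
          fun h => ⟨h.1.1, sub_nonneg.1 h.1.2, h.2.1, h.2.2⟩⟩
      exact hZeq ▸ hc1.inter (hc2.inter hc3)
    · refine (isBounded_iff_forall_norm_le).2 ⟨R, fun p hp => ?_⟩
      exact max_le (hZR p hp).1 (hZR p hp).2.1
  refine ⟨(fun q : (Euc n × Euc n) × ℝ => q.1.2 + q.2 • (q.1.1 - q.1.2)) '' (Z ×ˢ Icc 0 1), R,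
    (hZc.prod isCompact_Icc).image (by fun_prop), ?_, ?_, fun x hx hρ hxκ => ?_⟩
  · rintro _ ⟨⟨⟨x, ξ⟩, t⟩, ⟨⟨h1, h2, -, -⟩, ht⟩, rfl⟩
    refine ⟨ξ, h1, ?_⟩
    simp only at h2 ⊢
    rw [add_sub_cancel_left, norm_smul, Real.norm_of_nonneg ht.1]
    have := mul_le_of_le_one_left (norm_nonneg (x - ξ)) ht.2
    linarith [X.isTubular.eps_pos ξ h1]
  · linarith [abs_nonneg e, norm_nonneg ξ₀]
  · have hmem : (x, X.proj x) ∈ Z :=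
      ⟨X.isTubular.proj_mem x hx, hρ.le, norm_sub_proj_le hx hξ₀, hxκ⟩
    refine ⟨?_, (hZR _ hmem).2.2⟩
    rw [segment_eq_image']
    rintro _ ⟨t, ht, rfl⟩
    exact ⟨((x, X.proj x), t), ⟨hmem, ht⟩, rfl⟩

lemma taylorRemainder_eventuallyEq_zero {φ : Euc n → ℂ} (q : ℕ) {x : Euc n}
    (hx : x ∈ tube X.carrier X.eps) (hxφ : x ∉ tsupport φ) (hpφ : X.proj x ∉ tsupport φ) :
    X.taylorRemainder φ q =ᶠ[𝓝 x] 0 := by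
  have hcl := (isClosed_tsupport φ).isOpen_compl
  filter_upwards [hcl.mem_nhds hxφ,
    (contDiffAt_proj hx).continuousAt.preimage_mem_nhds (hcl.mem_nhds hpφ)] with y hy hyp
  have h0 : ∀ α : Fin d → ℕ, X.ambientNormalDeriv α φ (X.proj y) = 0 := fun α =>
    ambientNormalDeriv_eq_zero α (notMem_tsupport_iff_eventuallyEq.1 hyp)
  simp [taylorRemainder, taylorTerm, h0, image_eq_zero_of_notMem_tsupport hy]

/-- The Taylor remainder in the normal directions is a strong asymptotic remainder. -/
lemma exists_bound_iteratedFDeriv_taylorRemainder {φ : Euc n → ℂ} (hφ : ContDiff ℝ ∞ φ)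
    (hc : HasCompactSupport φ) (q : ℤ) (i : ℕ) :
    ∃ C : ℝ, ∀ x ∈ X.region Ω \ X.carrier,
      ‖iteratedFDeriv ℝ i (X.taylorRemainder φ q.toNat) x‖ ≤ C * X.rho x ^ (q - i) := by
  obtain ⟨W, R, hW, hWt, hR1, hWR⟩ := exists_isCompact_segment_subset (X := X) hc.isCompact
  have hs := contDiffOn_taylorRemainder (X := X) hφ q.toNat
  have hcont : ∀ r : ℕ, ContinuousOn (iteratedFDeriv ℝ r (X.taylorRemainder φ q.toNat)) W :=
    fun r x hx => ((hs.contDiffAt (isOpen_tube.mem_nhds (hWt hx))).iteratedFDeriv_right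
      (m := 0) (i := r) (by simpa using (natCast_lt_infty r).le)).continuousAt.continuousWithinAt
  have hout : ∀ x ∈ X.region Ω \ X.carrier, ¬ (x ∈ tsupport φ ∨ X.proj x ∈ tsupport φ) →
      iteratedFDeriv ℝ i (X.taylorRemainder φ q.toNat) x = 0 := by
    intro x hx h
    rw [not_or] at h
    have h1 := taylorRemainder_eventuallyEq_zero (X := X) q.toNat hx.1.2.1 h.1 h.2
    rw [(h1.iteratedFDeriv ℝ i).eq_of_nhds]
    simp
  rcases lt_or_ge q i with hqi | hqi
  · obtain ⟨M, hM⟩ := hW.exists_bound_of_continuousOn (hcont i)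
    refine ⟨|M| * R ^ (i - q), fun x hx => ?_⟩
    have hρ := rho_pos hx.1.2.1 hx.2
    by_cases h : x ∈ tsupport φ ∨ X.proj x ∈ tsupport φ
    · obtain ⟨hseg, hρR⟩ := hWR x hx.1.2.1 hx.1.2.2.1 h
      have h1 := (hM x (hseg (right_mem_segment ℝ _ _))).trans (le_abs_self M)
      -- The weight has negative exponent here, so `ρ ≤ R` bounds it below and mere boundedness of
      -- the derivative suffices.
      have h2 : 1 ≤ R ^ (i - q) * X.rho x ^ (q - i) := by
        rw [← neg_sub (i : ℤ) q, zpow_neg, ← div_eq_mul_inv, one_le_div (zpow_pos hρ _)]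
        exact zpow_le_zpow_left₀ (by lia) hρ.le hρR
      rw [mul_assoc]
      exact h1.trans (le_mul_of_one_le_right (abs_nonneg M) h2)
    · rw [hout x hx h, norm_zero]
      positivity
  · obtain ⟨M, hM⟩ := hW.exists_bound_of_continuousOn (hcont q.toNat)
    refine ⟨|M|, fun x hx => ?_⟩
    have hρ := rho_pos hx.1.2.1 hx.2
    by_cases h : x ∈ tsupport φ ∨ X.proj x ∈ tsupport φ
    · obtain ⟨hseg, -⟩ := hWR x hx.1.2.1 hx.1.2.2.1 h
      have h1 := norm_iteratedFDeriv_le_of_vanishing isOpen_tube hs (hseg.trans hWt)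
        (iteratedFDeriv_taylorRemainder_eq_zero hφ hc q.toNat (X.isTubular.proj_mem x hx.1.2.1))
        (fun y hy => (hM y (hseg hy)).trans (le_abs_self M)) (q.toNat - i) (Nat.sub_le _ _)
      -- In this case `0 ≤ i ≤ q`, so neither `toNat` nor the natural subtraction truncates.
      rw [show q.toNat - (q.toNat - i) = i by lia, ← zpow_natCast,
        show ((q.toNat - i : ℕ) : ℤ) = q - i by lia] at h1
      exact h1
    · rw [hout x hx h, norm_zero]
      positivity

/-! ### The expansion of a smooth test function and the projection formula -/

variable (X Ω) in
/-- The coefficients of the expansion of a smooth function. -/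
noncomputable def taylorCoeff (φ : Euc n → ℂ) (l : ℤ) : X.bundle Ω → ℂ :=
  if 0 ≤ l then ∑ α ∈ Finset.piAntidiag Finset.univ l.toNat,
    ((∏ k, (α k).factorial : ℕ) : ℂ)⁻¹ • mulMonomial α (X.normalDeriv Ω α φ) else 0

/-- The normal coordinates of `x` are `ρ ωₖ`, so a monomial of degree `|α| = l` in them is `ρ^l
ω^α`. -/
lemma term_taylorCoeff (φ : Euc n → ℂ) (l : ℕ) {x : Euc n} (hx : x ∈ X.region Ω \ X.carrier) :
    X.term Ω (X.taylorCoeff Ω φ l) l x = X.taylorTerm φ l x := by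
  have hmem : (X.proj x, X.omega x) ∈ X.bundle Ω :=
    ⟨⟨X.isTubular.proj_mem x hx.1.2.1, hx.1.2.2.2⟩, omega_mem hx.1.2.1 hx.2⟩
  have hρ := rho_pos hx.1.2.1 hx.2
  rw [term, zeroExt_of_mem _ hmem, taylorCoeff, if_pos (by positivity), taylorTerm,
    Int.toNat_natCast, Finset.sum_apply, Finset.sum_mul]
  refine Finset.sum_congr rfl fun α hα => ?_
  rw [Pi.smul_apply, smul_eq_mul, mul_assoc]
  congr 1
  rw [mulMonomial, mul_assoc]
  congr 1
  have hpow : ((X.rho x ^ (l : ℤ) : ℝ) : ℂ) = ∏ k, (X.rho x : ℂ) ^ α k := by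
    rw [Finset.prod_pow_eq_pow_sum, (Finset.mem_piAntidiag.1 hα).1]
    simp
  rw [hpow, ← Finset.prod_mul_distrib]
  refine Finset.prod_congr rfl fun k _ => ?_
  rw [← mul_pow, ← Complex.ofReal_mul]
  congr 2
  exact div_mul_cancel₀ _ hρ.ne'

lemma remainder_taylorCoeff (φ : Euc n → ℂ) (q : ℤ) {x : Euc n}
    (hx : x ∈ X.region Ω \ X.carrier) :
    X.remainder Ω 0 (X.carrierᶜ.indicator φ) (X.taylorCoeff Ω φ) q x =
      X.taylorRemainder φ q.toNat x := by
  rw [remainder, taylorRemainder, indicator_of_mem hx.2]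
  congr 1
  have h : Finset.Ico 0 q = (Finset.range q.toNat).map Nat.castEmbedding := by
    ext i
    simp only [Finset.mem_Ico, Finset.mem_map, Finset.mem_range, Nat.castEmbedding_apply]
    constructor
    · intro hi
      exact ⟨i.toNat, by lia, by lia⟩
    · rintro ⟨r, hr, rfl⟩
      lia
  rw [h, Finset.sum_map]
  exact Finset.sum_congr rfl fun l _ => term_taylorCoeff φ l hx

lemma isExpansion_taylorCoeff (φ : 𝓓(Ω, ℂ)) :
    X.IsExpansion Ω 0 (X.carrierᶜ.indicator φ) (X.taylorCoeff Ω φ) := by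
  refine ⟨fun l => ?_, fun l hl => if_neg (not_le.2 hl), fun q i => ?_⟩
  · have hmem : X.taylorCoeff Ω φ l ∈ SubTest (X.bundle Ω) := by
      unfold taylorCoeff
      split_ifs
      · exact sum_mem fun α _ => Submodule.smul_mem _ _
          (mulMonomial_mem α ⟨X.normalDeriv Ω α φ, normalDeriv_mem α φ⟩)
      · exact zero_mem _
    exact hmem.1
  · obtain ⟨C, hC⟩ := exists_bound_iteratedFDeriv_taylorRemainder (X := X) (Ω := Ω)
      φ.contDiff φ.hasCompactSupport q i
    refine ⟨C, fun x hx => ?_⟩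
    have hev : X.remainder Ω 0 (X.carrierᶜ.indicator φ) (X.taylorCoeff Ω φ) q =ᶠ[𝓝 x]
        X.taylorRemainder φ q.toNat := by
      filter_upwards [isOpen_region_diff.mem_nhds hx] with y hy
        using remainder_taylorCoeff φ q hy
    rw [(hev.iteratedFDeriv ℝ i).eq_of_nhds]
    exact hC x hx

lemma indicator_mem_thickTest (φ : 𝓓(Ω, ℂ)) : X.carrierᶜ.indicator φ ∈ X.ThickTest Ω := by
  refine ⟨?_, fun x hx => indicator_of_notMem (not_not_intro hx) _,
    ⟨tsupport φ, φ.hasCompactSupport, φ.tsupport_subset, fun x hx => ?_⟩, 0, _,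
    isExpansion_taylorCoeff φ⟩
  · exact φ.contDiff.contDiffOn.congr fun x hx => indicator_of_mem hx.2 _
  · exact indicator_apply_eq_zero.2 fun _ => image_eq_zero_of_notMem_tsupport hx

lemma isProjection_of_isThickDelta {g : SubDistribution (X.bundle Ω)} {j : ℕ}
    {T : X.ThickDistribution Ω} {L : (Fin d → ℕ) → 𝓓(Ω, ℂ) →L[ℂ] ℂ} (hT : IsThickDelta g j T)
    (hL : ∀ α, IsMultilayer (X := X) (angularMoment g α) α (L α)) :
    IsProjection T (((-1 : ℂ) ^ j / (sphereArea d : ℂ)) •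
      ∑ α ∈ Finset.piAntidiag Finset.univ j,
        ((∏ k, (α k).factorial : ℕ) : ℂ)⁻¹ • L α) := by
  intro φ
  obtain ⟨b, hb, hTb⟩ := hT ⟨_, indicator_mem_thickTest φ⟩ 0 _ (isExpansion_taylorCoeff φ)
  refine ⟨⟨_, indicator_mem_thickTest φ⟩, rfl, ?_⟩
  rw [hTb]
  have hbsum : b = ∑ α ∈ Finset.piAntidiag Finset.univ j,
      ((∏ k, (α k).factorial : ℕ) : ℂ)⁻¹ • (⟨mulMonomial α (X.normalDeriv Ω α φ),
        mulMonomial_mem α ⟨_, normalDeriv_mem α φ⟩⟩ : SubTest (X.bundle Ω)) := by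
    refine Subtype.ext ?_
    rw [hb, taylorCoeff, if_pos (by positivity), Int.toNat_natCast]
    simp
  -- One sign comes from the prefactor, the other from the multilayer, where `|α| = j`.
  have hsign : ((-1 : ℂ) ^ j) * (-1) ^ j = 1 := by
    rw [← mul_pow]
    simp
  rw [hbsum, map_sum, smul_apply, sum_apply, smul_eq_mul, Finset.mul_sum, Finset.mul_sum]
  refine Finset.sum_congr rfl fun α hα => ?_
  have h1 : L α φ = (-1) ^ (∑ k, α k) * g.toLinearMap ⟨mulMonomial α (X.normalDeriv Ω α φ),
      mulMonomial_mem α ⟨_, normalDeriv_mem α φ⟩⟩ := hL α φ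
  rw [smul_apply, h1, (Finset.mem_piAntidiag.1 hα).1, map_smul, smul_eq_mul, smul_eq_mul]
  set G := g.toLinearMap ⟨mulMonomial α (X.normalDeriv Ω α φ), _⟩
  linear_combination
    (sphereArea d : ℂ)⁻¹ * ((∏ k, (α k).factorial : ℕ) : ℂ)⁻¹ * G * hsign

end FramedSubmanifold

end ThickDist

theorem mainTheorem7 {n d : ℕ} (hd : 1 ≤ d) (X : ThickDist.FramedSubmanifold n d)
    (Ω : TopologicalSpace.Opens (ThickDist.Euc n)) (hΩ : (X.carrier ∩ Ω).Nonempty)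
    (g : ThickDist.SubDistribution (X.bundle Ω)) (j : ℕ) :
    (∃! T : X.ThickDistribution Ω, ThickDist.FramedSubmanifold.IsThickDelta g j T) ∧
    (∀ α : Fin d → ℕ, ∃! L : 𝓓(Ω, ℂ) →L[ℂ] ℂ,
      ThickDist.FramedSubmanifold.IsMultilayer (X := X)
        (ThickDist.FramedSubmanifold.angularMoment g α) α L) ∧
    (∀ (T : X.ThickDistribution Ω) (L : (Fin d → ℕ) → 𝓓(Ω, ℂ) →L[ℂ] ℂ),
      ThickDist.FramedSubmanifold.IsThickDelta g j T →
      (∀ α, ThickDist.FramedSubmanifold.IsMultilayer (X := X)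
        (ThickDist.FramedSubmanifold.angularMoment g α) α (L α)) →
      ThickDist.FramedSubmanifold.IsProjection T
        (((-1 : ℂ) ^ j / (ThickDist.FramedSubmanifold.sphereArea d : ℂ)) •
          ∑ α ∈ Finset.piAntidiag Finset.univ j,
            ((∏ k, (α k).factorial : ℕ) : ℂ)⁻¹ • L α)) := by
  exact ⟨⟨ThickDist.FramedSubmanifold.thickDelta g j,
      ThickDist.FramedSubmanifold.isThickDelta_thickDelta g j,
      fun _ hT => hT.unique (ThickDist.FramedSubmanifold.isThickDelta_thickDelta g j)⟩,
    fun α => ⟨ThickDist.FramedSubmanifold.multilayer _ α,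
      ThickDist.FramedSubmanifold.isMultilayer_multilayer _ α,
      fun _ hL => hL.unique (ThickDist.FramedSubmanifold.isMultilayer_multilayer _ α)⟩,
    fun _ _ hT hL => ThickDist.FramedSubmanifold.isProjection_of_isThickDelta hT hL⟩
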